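/- **Lemma (MSE in linear conditional IV).** *Model.* Let $(X_i,Z_i,A_i,Y_i)_{i\ge 1}$ be i.i.d. copies of $(X,Z,A,Y)$ with $X\in\mathbb R^d$, $Z,Y\in\mathbb R$ and $A\in\{0,1\}$ a.s. For $\theta_0\in\mathbb R^d$ and a measurable $f_0:\mathbb R^d\to\mathbb R$ let $\varepsilon=Y-\theta_0'XA-f_0(X)$, and assume that $Z$ and $\varepsilon$ are integrable with $\mathbb E[Z\mid X]=0$ and $\mathbb E[\varepsilon\mid X,Z]=0$. Assume $\mathbb E\|X\|^2<\infty$, $\mathbb E[A|Z|\|X\|^2]<\infty$, $\mathbb E[\varepsilon^2Z^2\|X\|^2]<\infty$, and let $$V=\mathbb E[XX'],\quad J=\mathbb E[AZXX'],\quad \Sigma=\mathbb E[\varepsilon^2Z^2XX'],\quad U=V^{1/2}J^{-1}\Sigma J^{-1}V^{1/2},$$ where $J$ is assumed invertible and $V^{1/2}$ is the positive semidefinite square root. *Nuisance estimate.* For each $n$, let $\hat f_n$ be a random function $\hat f_n(x)=\hat f_n(W_n,x)$, jointly measurable in $(W_n,x)$, where the random element $W_n$ (auxiliary data) is independent of the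 first $n$ observations. For $X$ taken to be one of these observations (so independent of $W_n$), assume $\hat f_n(X)\to f_0(X)$ in probability and $\big((\hat f_n(X)-f_0(X))^2Z^2\|X\|^2\big)_n$ uniformly integrable. *Estimator.* Let $\Theta\subseteq\mathbb R^d$ have $\theta_0$ in its interior ($\Theta=\mathbb R^d$ is allowed). Let $\hat\theta_n$ be any random vector with values in $\Theta$ a.s. which almost surely solves $$\frac1n\sum_{i=1}^n\big(Y_i-\theta'X_iA_i-\hat f_n(X_i)\big)X_iZ_i=0$$ whenever this equation has a solution $\theta\in\Theta$ (otherwise its value in $\Theta$ is arbitrary). Let $\mathrm{MSE}(\theta)=\mathbb E_X[(\theta'X-\theta_0'X)^2]$, the expectation being over $X$ only, so that $\mathrm{MSE}(\hat\theta_n)$ is a random variable. *Conclusions.* 1. Let $\lambda_1,\dots,\lambda_d$ be the singular values of $U$ and $\xi_1,\dots,\xi_d$ i.i.d. $N(0,1)$ (so the $\xi_j^2$ are independent $\chi^2(1)$). Then $n\,\mathrm{MSE}(\hat\theta_n)$ converges in distribution to $\sum_{j=1}^d\lambda_j\xi_j^2$, which is square integrable, with mean $\|U\|_{\mathrm{nuclear}}$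 and variance $2\|U\|_{\mathrm{Frobenius}}^2$. 2. Suppose moreover that $\Theta$ is bounded, that $\mathbb E[\varepsilon^4Z^4\|X\|^4]<\infty$ and $\mathbb E[A Z^4\|X\|^8]<\infty$, and that $\big((\hat f_n(X)-f_0(X))^4Z^4\|X\|^4\big)_n$ is uniformly integrable. Then $\mathrm{MSE}(\hat\theta_n)$ is square integrable for every $n$ and, as $n\to\infty$, $$n\,\mathbb E[\mathrm{MSE}(\hat\theta_n)]\to\|U\|_{\mathrm{nuclear}},\qquad n^2\,\mathrm{Var}[\mathrm{MSE}(\hat\theta_n)]\to 2\|U\|_{\mathrm{Frobenius}}^2 .$$ -/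

import Mathlib

open MeasureTheory ProbabilityTheory Filter Topology
open scoped MatrixOrder

noncomputable section

/-- The second-moment matrix `V = E[X Xᵀ]` of a random vector. -/
def covariateMatrix {Ω : Type*} [MeasurableSpace Ω] (P : Measure Ω) {d : ℕ}
    (X : Ω → EuclideanSpace ℝ (Fin d)) : Matrix (Fin d) (Fin d) ℝ :=
  Matrix.of fun i j => ∫ ω, X ω i * X ω j ∂P

/-- The Jacobian matrix `J = E[A Z X Xᵀ]`. -/
def jacobianMatrix {Ω : Type*} [MeasurableSpace Ω] (P : Measure Ω) {d : ℕ}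
    (X : Ω → EuclideanSpace ℝ (Fin d)) (Z A : Ω → ℝ) : Matrix (Fin d) (Fin d) ℝ :=
  Matrix.of fun i j => ∫ ω, A ω * Z ω * (X ω i * X ω j) ∂P

/-- The matrix `Σ = E[ε² Z² X Xᵀ]`. -/
def scoreMatrix {Ω : Type*} [MeasurableSpace Ω] (P : Measure Ω) {d : ℕ}
    (X : Ω → EuclideanSpace ℝ (Fin d)) (Z ε : Ω → ℝ) : Matrix (Fin d) (Fin d) ℝ :=
  Matrix.of fun i j => ∫ ω, ε ω ^ 2 * Z ω ^ 2 * (X ω i * X ω j) ∂P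

/-- The matrix `U = V^{1/2} J⁻¹ Σ J⁻¹ V^{1/2}`, where `V^{1/2}` is the positive semidefinite
square root of `V`. -/
def limitMatrix {d : ℕ} (V J S : Matrix (Fin d) (Fin d) ℝ) : Matrix (Fin d) (Fin d) ℝ :=
  CFC.sqrt V * J⁻¹ * S * J⁻¹ * CFC.sqrt V

/-- The `j`-th singular value of a square matrix (in descending order, with multiplicity). -/
def matrixSingularValue {d : ℕ} (M : Matrix (Fin d) (Fin d) ℝ) (j : Fin d) : ℝ :=
  (Matrix.toEuclideanLin M).singularValues j

/-- The nuclear (trace) norm: the sum of the singular values. -/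
def nuclearNorm {d : ℕ} (M : Matrix (Fin d) (Fin d) ℝ) : ℝ :=
  ∑ j, matrixSingularValue M j

/-- The Frobenius norm. -/
def frobeniusNorm {d : ℕ} (M : Matrix (Fin d) (Fin d) ℝ) : ℝ :=
  @norm _ (Matrix.frobeniusNormedAddCommGroup (m := Fin d) (n := Fin d) (α := ℝ)).toNorm M

/-- The structural residual `ε = Y - θ₀ᵀ X A - f₀(X)`. -/
def structuralResidual {Ω : Type*} {d : ℕ} (θ₀ : EuclideanSpace ℝ (Fin d))
    (f₀ : EuclideanSpace ℝ (Fin d) → ℝ) (X : Ω → EuclideanSpace ℝ (Fin d)) (A Y : Ω → ℝ) :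
    Ω → ℝ :=
  fun ω => Y ω - inner ℝ θ₀ (X ω) * A ω - f₀ (X ω)

/-- The empirical moment vector `(1/n) ∑_{i < n} (Yᵢ - θᵀ Xᵢ Aᵢ - g(Xᵢ)) Xᵢ Zᵢ`. -/
def sampleMoment {Ω : Type*} {d : ℕ} (X : ℕ → Ω → EuclideanSpace ℝ (Fin d))
    (Z A Y : ℕ → Ω → ℝ) (n : ℕ) (ω : Ω) (g : EuclideanSpace ℝ (Fin d) → ℝ)
    (θ : EuclideanSpace ℝ (Fin d)) : EuclideanSpace ℝ (Fin d) :=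
  (n : ℝ)⁻¹ • ∑ i ∈ Finset.range n,
    ((Y i ω - inner ℝ θ (X i ω) * A i ω - g (X i ω)) * Z i ω) • X i ω

/-- The mean squared prediction error `MSE(θ) = E_X[(θᵀ X - θ₀ᵀ X)²]` of a parameter `θ`; the
expectation is over `X` alone, so for an estimate `θ = θ̂` it is a random variable. -/
def predictionMSE {Ω : Type*} [MeasurableSpace Ω] (P : Measure Ω) {d : ℕ}
    (X : Ω → EuclideanSpace ℝ (Fin d)) (θ₀ θ : EuclideanSpace ℝ (Fin d)) : ℝ :=
  ∫ ω, (inner ℝ θ (X ω) - inner ℝ θ₀ (X ω)) ^ 2 ∂P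

/-- `∑ⱼ λⱼ ξⱼ²`. Under the law of a standard Gaussian vector `ξ` the `ξⱼ²` are independent
`χ²(1)` variables. -/
def weightedSumSq {d : ℕ} (lam : Fin d → ℝ) (ξ : Fin d → ℝ) : ℝ :=
  ∑ j, lam j * ξ j ^ 2

end

open scoped NNReal ENNReal

/-! Put `T n = √n (θ̂ₙ - θ₀)`. The moment equation is affine in `θ` and reads `Jₙ T = S - R`, with
`Jₙ` the empirical Jacobian, `S = n^{-1/2} ∑ εᵢ Zᵢ Xᵢ` the score and `R = n^{-1/2} ∑ (f̂ₙ - f₀)(Xᵢ)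
Zᵢ Xᵢ` the nuisance error (`sampleMoment_eq`). If `Jₙ` is close to `J` and `S`, `R` are at most a
small multiple of `√n`, then `Jₙ` is invertible and the root lies in a ball around `θ₀` inside `Θ`,
so the estimator is that root (`moment_solution_bounds`).

Given `W n`, the summands of `R` are i.i.d., and `E[Z | X] = 0` centres them whatever `f̂ₙ` is.
Hence the moments of `R` are bounded by those of one summand, which vanish by uniform integrability;
no rate for `f̂ₙ` is needed (`tendsto_lintegral_nuisanceTerm`). Therefore `T = J⁻¹ S + o_P(1)`.
Since `n MSE = ‖V^{1/2} T‖²`, the central limit theorem gives the law of `‖G‖²` with `G` centred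
Gaussian of covariance `U`. In an eigenbasis of `U`, whose eigenvalues are its singular values
because `U` is positive semidefinite, this is `∑ λⱼ ξⱼ²`.

For the moments, `‖T‖⁴` has to be uniformly integrable. On the good event `‖T‖` is at most a
constant times `‖S‖ + ‖R‖`; elsewhere boundedness of `Θ` gives only `‖T‖⁴ ≤ B⁴ n²`, so the bad event
must have probability `o(n⁻²)`. Markov with bounded fourth moments gives just `O(n⁻²)`. The gain
comes from uniform integrability of the fourth powers of `S` and `√n (Jₙ - J)`, which follows from
the central limit theorem together with convergence of fourth moments to the Gaussian value `3v²`
(`asympUnifIntegrable_normalized_sum_pow_four`, `tendsto_sq_mul_measure_norm_gt`). -/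

/-! ### Gaussian moments. -/

/-- Every derivative of the moment generating function `exp (v t² / 2)` is a polynomial times the
same exponential, and differentiation acts on the polynomial by `p ↦ p' + v X p`. Four such steps
from `p = 1`, evaluated at `0`, give the moment. -/
theorem integral_pow_four_gaussianReal (v : ℝ≥0) :
    ∫ x, x ^ 4 ∂gaussianReal 0 v = 3 * (v : ℝ) ^ 2 := by
  have h4 : ∫ x, x ^ 4 ∂gaussianReal 0 v
      = iteratedDeriv 4 (mgf (fun x => x) (gaussianReal 0 v)) 0 := by
    rw [iteratedDeriv_mgf_zero] <;> simp
  have h0 (t : ℝ) : HasDerivAt (fun t : ℝ => Real.exp (v * t ^ 2 / 2))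
      (Real.exp (v * t ^ 2 / 2) * (v * t)) t := by
    have := (((hasDerivAt_pow 2 t).const_mul (v : ℝ)).div_const 2).exp
    convert! this using 1
    simp; ring
  have hstep (p : Polynomial ℝ) (t : ℝ) :
      HasDerivAt (fun t : ℝ => p.eval t * Real.exp (v * t ^ 2 / 2))
        ((p.derivative + p * (Polynomial.C (v : ℝ) * Polynomial.X)).eval t
          * Real.exp (v * t ^ 2 / 2)) t := by
    convert! (p.hasDerivAt t).mul (h0 t) using 1
    simp; ring
  have hd (p : Polynomial ℝ) : deriv (fun t : ℝ => p.eval t * Real.exp (v * t ^ 2 / 2))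
      = fun t => (p.derivative + p * (Polynomial.C (v : ℝ) * Polynomial.X)).eval t
          * Real.exp (v * t ^ 2 / 2) := funext fun t => (hstep p t).deriv
  have hm : mgf (fun x => x) (gaussianReal 0 v)
      = fun t => (1 : Polynomial ℝ).eval t * Real.exp (v * t ^ 2 / 2) := by
    rw [mgf_fun_id_gaussianReal]; simp
  rw [h4, hm, iteratedDeriv_succ', hd, iteratedDeriv_succ', hd, iteratedDeriv_succ', hd,
    iteratedDeriv_one, hd]
  simp
  ring

theorem memLp_pow_gaussianReal (k : ℕ) (p : ℝ≥0) (v : ℝ≥0) :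
    MemLp (fun x : ℝ => x ^ k) p (gaussianReal 0 v) := by
  have h := (memLp_id_gaussianReal (μ := 0) (v := v) (p * k))
  rcases Nat.eq_zero_or_pos k with rfl | hk
  · simpa using memLp_const (1 : ℝ)
  have h2 := h.norm_rpow_div (k : ℝ≥0∞)
  have e : ((p * k : ℝ≥0) : ℝ≥0∞) / (k : ℝ≥0∞) = p := by
    push_cast
    exact ENNReal.mul_div_cancel_right (by simpa using hk.ne') (by simp)
  rw [e] at h2
  refine h2.mono (by fun_prop) (ae_of_all _ fun x => ?_)
  simp

theorem integral_sq_gaussianReal (v : ℝ≥0) : ∫ x, x ^ 2 ∂gaussianReal 0 v = v := by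
  have := variance_fun_id_gaussianReal (μ := 0) (v := v)
  rw [variance_eq_integral (by fun_prop), integral_id_gaussianReal] at this
  simpa using this

/-! ### Moments of the limit law. -/

section weightedSumSq

variable {d : ℕ} (lam : Fin d → ℝ)

theorem memLp_weightedSumSq :
    MemLp (weightedSumSq lam) 2 (Measure.pi fun _ : Fin d => gaussianReal 0 1) := by
  unfold weightedSumSq
  refine memLp_finsetSum _ fun j _ => MemLp.const_mul ?_ _
  exact (memLp_pow_gaussianReal 2 2 1).comp_measurePreserving
    (measurePreserving_eval (fun _ : Fin d => gaussianReal 0 1) j)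

theorem integral_weightedSumSq :
    ∫ ξ, weightedSumSq lam ξ ∂(Measure.pi fun _ : Fin d => gaussianReal 0 1) = ∑ j, lam j := by
  unfold weightedSumSq
  rw [integral_finsetSum]
  · refine Finset.sum_congr rfl fun j _ => ?_
    rw [integral_const_mul, integral_comp_eval (μ := fun _ : Fin d => gaussianReal 0 1)
      (f := fun x : ℝ => x ^ 2) (by fun_prop), integral_sq_gaussianReal]
    simp
  · intro j _
    refine Integrable.const_mul ?_ _
    exact (((memLp_pow_gaussianReal 2 1 1).comp_measurePreserving
      (measurePreserving_eval (fun _ : Fin d => gaussianReal 0 1) j))).integrable (by simp)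

theorem variance_weightedSumSq :
    variance (weightedSumSq lam) (Measure.pi fun _ : Fin d => gaussianReal 0 1)
      = 2 * ∑ j, lam j ^ 2 := by
  have e : weightedSumSq lam = ∑ j, fun ξ : Fin d → ℝ => lam j * ξ j ^ 2 := by
    ext ξ; simp [weightedSumSq]
  rw [e, variance_sum_pi (μ := fun _ : Fin d => gaussianReal 0 1)
    (X := fun j (x : ℝ) => lam j * x ^ 2), Finset.mul_sum]
  · refine Finset.sum_congr rfl fun j _ => ?_
    rw [variance_const_mul, variance_eq_sub (memLp_pow_gaussianReal 2 2 1)]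
    have : ((fun x : ℝ => x ^ 2) ^ 2 : ℝ → ℝ) = fun x => x ^ 4 := by ext x; simp; ring
    rw [this, integral_pow_four_gaussianReal, integral_sq_gaussianReal]
    norm_num; ring
  · exact fun j => (memLp_pow_gaussianReal 2 2 1).const_mul _

end weightedSumSq

/-! ### Second and fourth moments of i.i.d. sums. -/

section iid

variable {Ω : Type*} [MeasurableSpace Ω] {P : Measure Ω} {X : ℕ → Ω → ℝ}

theorem MeasureTheory.MemLp.integrable_pow_of_le [IsProbabilityMeasure P] {f : Ω → ℝ} {m k : ℕ} (hf : MemLp f m P)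
    (hk : k ≤ m) : Integrable (fun ω => f ω ^ k) P := by
  have h1 : MemLp f k P := hf.mono_exponent (by exact_mod_cast hk)
  have := h1.integrable_norm_pow' 
  refine this.mono (h1.1.pow k) (ae_of_all _ fun ω => ?_)
  simp

theorem iid_indepFun_sum (hm : ∀ i, Measurable (X i)) (hind : iIndepFun X P) (n : ℕ) :
    IndepFun (fun ω => ∑ i ∈ Finset.range n, X i ω) (X n) P := by
  have := hind.indepFun_finsetSum_of_notMem hm (s := Finset.range n) (i := n) (by simp)
  convert! this using 1
  ext ω; simp

theorem integral_pow_mul_pow_of_indep {S T : Ω → ℝ} (hS : Measurable S)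
    (hT : Measurable T) (h : IndepFun S T P) (k l : ℕ) :
    ∫ ω, S ω ^ k * T ω ^ l ∂P = (∫ ω, S ω ^ k ∂P) * ∫ ω, T ω ^ l ∂P :=
  (h.comp (measurable_id.pow_const k) (measurable_id.pow_const l)).integral_fun_mul_eq_mul_integral
    (by fun_prop) (by fun_prop)

theorem integrable_pow_mul_pow_of_indep [IsProbabilityMeasure P] {S T : Ω → ℝ} {m k l : ℕ} (hSm : MemLp S m P)
    (hTm : MemLp T m P) (h : IndepFun S T P) (hk : k ≤ m) (hl : l ≤ m) :
    Integrable (fun ω => S ω ^ k * T ω ^ l) P :=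
  (h.comp (measurable_id.pow_const k) (measurable_id.pow_const l)).integrable_mul
    (hSm.integrable_pow_of_le hk) (hTm.integrable_pow_of_le hl)

theorem memLp_iid_sum (hid : ∀ i, IdentDistrib (X i) (X 0) P P) {p : ℝ≥0∞}
    (h : MemLp (X 0) p P) (n : ℕ) : MemLp (fun ω => ∑ i ∈ Finset.range n, X i ω) p P :=
  memLp_finsetSum _ fun i _ => (hid i).symm.memLp_snd h

theorem integral_iid_sum (hid : ∀ i, IdentDistrib (X i) (X 0) P P)
    (hint : Integrable (X 0) P) (h0 : ∫ ω, X 0 ω ∂P = 0) (n : ℕ) :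
    ∫ ω, ∑ i ∈ Finset.range n, X i ω ∂P = 0 := by
  rw [integral_finsetSum _ fun i _ => (hid i).symm.integrable_snd hint]
  exact Finset.sum_eq_zero fun i _ => by rw [(hid i).integral_eq, h0]

theorem integral_iid_sum_sq [IsProbabilityMeasure P] (hm : ∀ i, Measurable (X i)) (hind : iIndepFun X P)
    (hid : ∀ i, IdentDistrib (X i) (X 0) P P)
    (h2 : MemLp (X 0) 2 P) (h0 : ∫ ω, X 0 ω ∂P = 0) (n : ℕ) :
    ∫ ω, (∑ i ∈ Finset.range n, X i ω) ^ 2 ∂P = n * ∫ ω, X 0 ω ^ 2 ∂P := by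
  induction n with
  | zero => simp
  | succ n ih =>
    have hI := iid_indepFun_sum hm hind n
    have hSm : Measurable (fun ω => ∑ i ∈ Finset.range n, X i ω) := by fun_prop
    have hSL : MemLp (fun ω => ∑ i ∈ Finset.range n, X i ω) (2 : ℕ) P := memLp_iid_sum hid h2 n
    have hXL : MemLp (X n) (2 : ℕ) P := (hid n).symm.memLp_snd h2
    have hX2 : ∫ ω, X n ω ^ 2 ∂P = ∫ ω, X 0 ω ^ 2 ∂P :=
      ((hid n).comp (measurable_id.pow_const 2)).integral_eq
    have hX1 : ∫ ω, X n ω ^ 1 ∂P = 0 := by simp [(hid n).integral_eq, h0]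
    simp_rw [Finset.sum_range_succ]
    set S := fun ω => ∑ i ∈ Finset.range n, X i ω with hS
    have i1 := integrable_pow_mul_pow_of_indep hSL hXL hI (k := 2) (l := 0) (by simp) (by simp)
    have i2 := integrable_pow_mul_pow_of_indep hSL hXL hI (k := 1) (l := 1) (by simp) (by simp)
    have i3 := integrable_pow_mul_pow_of_indep hSL hXL hI (k := 0) (l := 2) (by simp) (by simp)
    -- The powers `0` and `1` are kept explicit so that one factorization lemma for independent
    -- variables handles every term.
    have e : ∀ ω, (S ω + X n ω) ^ 2
        = S ω ^ 2 * X n ω ^ 0 + (2 * (S ω ^ 1 * X n ω ^ 1) + S ω ^ 0 * X n ω ^ 2) := fun ω => by ring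
    change ∫ ω, S ω ^ 2 ∂P = _ at ih
    change ∫ ω, (S ω + X n ω) ^ 2 ∂P = _
    simp_rw [e]
    rw [integral_add i1 ((i2.const_mul 2).fun_add i3), integral_add (i2.const_mul 2) i3,
      integral_const_mul]
    simp only [integral_pow_mul_pow_of_indep hSm (hm n) hI, hX1, hX2, ih]
    simp
    ring

/-- Expand `(S + Xₙ)⁴` with `S` independent of `Xₙ`: the terms `S³ Xₙ` and `S Xₙ³` vanish as both
variables are centred, and `6 S² Xₙ²` contributes `6 n (E X²)²`. -/
theorem integral_iid_sum_pow_four [IsProbabilityMeasure P] (hm : ∀ i, Measurable (X i)) (hind : iIndepFun X P)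
    (hid : ∀ i, IdentDistrib (X i) (X 0) P P)
    (h4 : MemLp (X 0) 4 P) (h0 : ∫ ω, X 0 ω ∂P = 0) (n : ℕ) :
    ∫ ω, (∑ i ∈ Finset.range n, X i ω) ^ 4 ∂P
      = n * ∫ ω, X 0 ω ^ 4 ∂P + 3 * n * (n - 1) * (∫ ω, X 0 ω ^ 2 ∂P) ^ 2 := by
  induction n with
  | zero => simp
  | succ n ih =>
    have hI := iid_indepFun_sum hm hind n
    have hSm : Measurable (fun ω => ∑ i ∈ Finset.range n, X i ω) := by fun_prop
    have hSL : MemLp (fun ω => ∑ i ∈ Finset.range n, X i ω) (4 : ℕ) P := memLp_iid_sum hid h4 n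
    have hXL : MemLp (X n) (4 : ℕ) P := (hid n).symm.memLp_snd h4
    have hX2 : ∫ ω, X n ω ^ 2 ∂P = ∫ ω, X 0 ω ^ 2 ∂P :=
      ((hid n).comp (measurable_id.pow_const 2)).integral_eq
    have hX4 : ∫ ω, X n ω ^ 4 ∂P = ∫ ω, X 0 ω ^ 4 ∂P :=
      ((hid n).comp (measurable_id.pow_const 4)).integral_eq
    have hX1 : ∫ ω, X n ω ^ 1 ∂P = 0 := by simp [(hid n).integral_eq, h0]
    have h24 : (2 : ℝ≥0∞) ≤ 4 := by norm_num
    have hS2 := integral_iid_sum_sq hm hind hid (h4.mono_exponent h24) h0 n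
    have hS1 : ∫ ω, (∑ i ∈ Finset.range n, X i ω) ^ 1 ∂P = 0 := by
      simpa using integral_iid_sum hid (h4.integrable (by norm_num)) h0 n
    simp_rw [Finset.sum_range_succ]
    set S := fun ω => ∑ i ∈ Finset.range n, X i ω with hS
    have i0 := integrable_pow_mul_pow_of_indep hSL hXL hI (k := 4) (l := 0) (by simp) (by simp)
    have i1 := integrable_pow_mul_pow_of_indep hSL hXL hI (k := 3) (l := 1) (by simp) (by simp)
    have i2 := integrable_pow_mul_pow_of_indep hSL hXL hI (k := 2) (l := 2) (by simp) (by simp)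
    have i3 := integrable_pow_mul_pow_of_indep hSL hXL hI (k := 1) (l := 3) (by simp) (by simp)
    have i4 := integrable_pow_mul_pow_of_indep hSL hXL hI (k := 0) (l := 4) (by simp) (by simp)
    have e : ∀ ω, (S ω + X n ω) ^ 4
        = S ω ^ 4 * X n ω ^ 0 + (4 * (S ω ^ 3 * X n ω ^ 1) + (6 * (S ω ^ 2 * X n ω ^ 2)
          + (4 * (S ω ^ 1 * X n ω ^ 3) + S ω ^ 0 * X n ω ^ 4))) := fun ω => by ring
    change ∫ ω, S ω ^ 4 ∂P = _ at ih
    change ∫ ω, S ω ^ 1 ∂P = _ at hS1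
    change ∫ ω, (S ω + X n ω) ^ 4 ∂P = _
    simp_rw [e]
    rw [integral_add i0 ((i1.const_mul 4).fun_add ((i2.const_mul 6).fun_add ((i3.const_mul 4).fun_add i4))),
      integral_add (i1.const_mul 4) ((i2.const_mul 6).fun_add ((i3.const_mul 4).fun_add i4)),
      integral_add (i2.const_mul 6) ((i3.const_mul 4).fun_add i4), integral_add (i3.const_mul 4) i4,
      integral_const_mul, integral_const_mul, integral_const_mul]
    simp only [integral_pow_mul_pow_of_indep hSm (hm n) hI, hX1, hX2, hX4, hS1, ih]
    rw [show ∫ ω, S ω ^ 2 ∂P = n * ∫ ω, X 0 ω ^ 2 ∂P from hS2]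
    simp
    ring

theorem lintegral_enorm_pow_eq_ofReal [IsProbabilityMeasure P] {f : Ω → ℝ} {m : ℕ} (hm : Even m)
    (hf : MemLp f m P) : ∫⁻ ω, ‖f ω‖ₑ ^ m ∂P = ENNReal.ofReal (∫ ω, f ω ^ m ∂P) := by
  rw [ofReal_integral_eq_lintegral_ofReal (hf.integrable_pow_of_le le_rfl)
    (ae_of_all _ fun ω => hm.pow_nonneg _)]
  refine lintegral_congr fun ω => ?_
  rw [← ofReal_norm, ← ENNReal.ofReal_pow (norm_nonneg _), Real.norm_eq_abs, hm.pow_abs]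

theorem memLp_natCast_iff_lintegral_lt_top {f : Ω → ℝ} {m : ℕ} (hm : m ≠ 0)
    (hf : AEStronglyMeasurable f P) : MemLp f m P ↔ ∫⁻ ω, ‖f ω‖ₑ ^ m ∂P < ∞ := by
  rw [MemLp, and_iff_right hf, eLpNorm_lt_top_iff_lintegral_rpow_enorm_lt_top (by simpa using hm)
    (by simp)]
  simp

/-- Centring is required only under integrability: if the second moment is infinite the bound is
trivial. This lets the lemma be applied with the nuisance estimate frozen at any value, without an
integrability check. -/
theorem lintegral_enorm_normalized_sum_sq_le [IsProbabilityMeasure P]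
    (hm : ∀ i, Measurable (X i)) (hind : iIndepFun X P)
    (hid : ∀ i, IdentDistrib (X i) (X 0) P P) (h0 : Integrable (X 0) P → ∫ ω, X 0 ω ∂P = 0)
    (n : ℕ) :
    ∫⁻ ω, ‖(√n)⁻¹ * ∑ i ∈ Finset.range n, X i ω‖ₑ ^ 2 ∂P ≤ ∫⁻ ω, ‖X 0 ω‖ₑ ^ 2 ∂P := by
  by_cases h : MemLp (X 0) (2 : ℕ) P
  · rw [lintegral_enorm_pow_eq_ofReal (by decide) h,
      lintegral_enorm_pow_eq_ofReal (by decide) ((memLp_iid_sum hid h n).const_mul _)]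
    refine ENNReal.ofReal_le_ofReal ?_
    simp_rw [mul_pow]
    rw [integral_const_mul, integral_iid_sum_sq hm hind hid h (h0 (h.integrable (by simp)))]
    rcases Nat.eq_zero_or_pos n with rfl | hn
    · simpa using integral_nonneg fun ω => sq_nonneg _
    · have : (0 : ℝ) < n := by exact_mod_cast hn
      rw [inv_pow, Real.sq_sqrt this.le, inv_mul_cancel_left₀ this.ne']
  · rw [memLp_natCast_iff_lintegral_lt_top (by simp) (hm 0).aestronglyMeasurable, not_lt,
      top_le_iff] at h
    rw [h]
    exact le_top

theorem integral_normalized_sum_pow_four [IsProbabilityMeasure P]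
    (hm : ∀ i, Measurable (X i)) (hind : iIndepFun X P)
    (hid : ∀ i, IdentDistrib (X i) (X 0) P P)
    (h4 : MemLp (X 0) 4 P) (h0 : ∫ ω, X 0 ω ∂P = 0) {n : ℕ} (hn : 0 < n) :
    ∫ ω, ((√n)⁻¹ * ∑ i ∈ Finset.range n, X i ω) ^ 4 ∂P
      = (n : ℝ)⁻¹ * ∫ ω, X 0 ω ^ 4 ∂P + 3 * (1 - (n : ℝ)⁻¹) * (∫ ω, X 0 ω ^ 2 ∂P) ^ 2 := by
  have : (0 : ℝ) < n := by exact_mod_cast hn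
  simp_rw [mul_pow]
  rw [integral_const_mul, integral_iid_sum_pow_four hm hind hid h4 h0, inv_pow,
    show (√(n : ℝ)) ^ 4 = (n : ℝ) ^ 2 by rw [show 4 = 2 * 2 from rfl, pow_mul, Real.sq_sqrt this.le]]
  field_simp

theorem lintegral_enorm_normalized_sum_pow_four_le [IsProbabilityMeasure P]
    (hm : ∀ i, Measurable (X i)) (hind : iIndepFun X P)
    (hid : ∀ i, IdentDistrib (X i) (X 0) P P) (h0 : Integrable (X 0) P → ∫ ω, X 0 ω ∂P = 0)
    (n : ℕ) :
    ∫⁻ ω, ‖(√n)⁻¹ * ∑ i ∈ Finset.range n, X i ω‖ₑ ^ 4 ∂P ≤ 3 * ∫⁻ ω, ‖X 0 ω‖ₑ ^ 4 ∂P := by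
  rcases Nat.eq_zero_or_pos n with rfl | hn
  · simp
  by_cases h : MemLp (X 0) (4 : ℕ) P
  · rw [lintegral_enorm_pow_eq_ofReal (by decide) h,
      lintegral_enorm_pow_eq_ofReal (by decide) ((memLp_iid_sum hid h n).const_mul _)]
    rw [show (3 : ℝ≥0∞) = ENNReal.ofReal 3 by simp, ← ENNReal.ofReal_mul (by norm_num)]
    refine ENNReal.ofReal_le_ofReal ?_
    rw [integral_normalized_sum_pow_four hm hind hid h (h0 (h.integrable (by simp))) hn]
    have h2 : MemLp (fun ω => X 0 ω ^ 2) 2 P := by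
      rw [memLp_two_iff_integrable_sq ((hm 0).pow_const 2).aestronglyMeasurable]
      simp_rw [← pow_mul]
      exact h.integrable_pow_of_le (k := 4) le_rfl
    -- The constant `3` comes from `(E X²)² ≤ E X⁴`, that is, from nonnegativity of the variance of
    -- `X²`.
    have hv := variance_nonneg (fun ω => X 0 ω ^ 2) P
    rw [variance_eq_sub h2] at hv
    have e : ((fun ω => X 0 ω ^ 2) ^ 2 : Ω → ℝ) = fun ω => X 0 ω ^ 4 := by ext ω; simp; ring
    rw [e] at hv
    have h1 : (1 : ℝ) ≤ n := by exact_mod_cast hn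
    have h1' : (n : ℝ)⁻¹ ≤ 1 := inv_le_one_of_one_le₀ h1
    have h1'' : 0 ≤ (n : ℝ)⁻¹ := by positivity
    have hq : 0 ≤ (∫ ω, X 0 ω ^ 2 ∂P) ^ 2 := sq_nonneg _
    nlinarith [mul_nonneg (sub_nonneg.2 h1') hv,
      mul_nonneg h1'' hq, mul_nonneg h1'' hv]
  · rw [memLp_natCast_iff_lintegral_lt_top (by simp) (hm 0).aestronglyMeasurable, not_lt,
      top_le_iff] at h
    rw [h]
    simp

end iid

/-! ### Asymptotic uniform integrability. -/

section AsympUnifIntegrable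

variable {Ω : Type*} [MeasurableSpace Ω] {P : Measure Ω}

/-- Asymptotic uniform integrability of a sequence of nonnegative random variables, expressed
through the excess `Y - K` over large constants `K`. -/
def AsympUnifIntegrable (P : Measure Ω) (Y : ℕ → Ω → ℝ≥0∞) : Prop :=
  ∀ η : ℝ≥0∞, η ≠ 0 → ∃ K : ℝ≥0, ∀ᶠ n in atTop, ∫⁻ ω, (Y n ω - K) ∂P ≤ η

namespace AsympUnifIntegrable

variable {Y Y' : ℕ → Ω → ℝ≥0∞}

theorem mono (h : AsympUnifIntegrable P Y) (hle : ∀ᶠ n in atTop, ∀ᵐ ω ∂P, Y' n ω ≤ Y n ω) :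
    AsympUnifIntegrable P Y' := by
  intro η hη
  obtain ⟨K, hK⟩ := h η hη
  refine ⟨K, ?_⟩
  filter_upwards [hK, hle] with n h1 h2
  refine (lintegral_mono_ae ?_).trans h1
  filter_upwards [h2] with ω hω using tsub_le_tsub_right hω _

theorem add (h : AsympUnifIntegrable P Y) (h' : AsympUnifIntegrable P Y')
    (hm : ∀ n, Measurable (Y n)) : AsympUnifIntegrable P (fun n ω => Y n ω + Y' n ω) := by
  intro η hη
  obtain ⟨K, hK⟩ := h (η / 2) (by simpa using hη)
  obtain ⟨K', hK'⟩ := h' (η / 2) (by simpa using hη)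
  refine ⟨K + K', ?_⟩
  filter_upwards [hK, hK'] with n h1 h2
  calc ∫⁻ ω, (Y n ω + Y' n ω - ↑(K + K')) ∂P
      ≤ ∫⁻ ω, ((Y n ω - K) + (Y' n ω - K')) ∂P := by
        refine lintegral_mono fun ω => ?_
        push_cast
        exact add_tsub_add_le_tsub_add_tsub
    _ = ∫⁻ ω, (Y n ω - K) ∂P + ∫⁻ ω, (Y' n ω - K') ∂P :=
        lintegral_add_left ((hm n).sub_const _) _
    _ ≤ η / 2 + η / 2 := add_le_add h1 h2
    _ = η := ENNReal.add_halves η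

theorem sum {ι : Type*} (s : Finset ι) {Y : ι → ℕ → Ω → ℝ≥0∞}
    (h : ∀ i ∈ s, AsympUnifIntegrable P (Y i)) (hm : ∀ i n, Measurable (Y i n)) :
    AsympUnifIntegrable P (fun n ω => ∑ i ∈ s, Y i n ω) := by
  classical
  induction s using Finset.induction_on with
  | empty => exact fun η _ => ⟨0, by simp⟩
  | insert a s ha ih =>
    simp_rw [Finset.sum_insert ha]
    exact (h a (by simp)).add (ih fun i hi => h i (by simp [hi])) (hm a)

theorem const_mul (h : AsympUnifIntegrable P Y) (c : ℝ≥0) :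
    AsympUnifIntegrable P (fun n ω => c * Y n ω) := by
  intro η hη
  rcases eq_or_ne c 0 with rfl | hc
  · exact ⟨0, by simp⟩
  obtain ⟨K, hK⟩ := h (η / c) (by simp [hη])
  refine ⟨c * K, ?_⟩
  filter_upwards [hK] with n h1
  have e : ∀ ω, (c : ℝ≥0∞) * Y n ω - ↑(c * K) = c * (Y n ω - K) := fun ω => by
    rw [ENNReal.mul_sub (by simp), ENNReal.coe_mul]
  simp_rw [e]
  rw [lintegral_const_mul' _ _ (by simp)]
  refine (mul_le_mul_right h1 _).trans ?_
  rw [ENNReal.mul_div_cancel (by simpa using hc) (by simp)]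

theorem of_tendsto_lintegral_zero (h : Tendsto (fun n => ∫⁻ ω, Y n ω ∂P) atTop (𝓝 0)) :
    AsympUnifIntegrable P Y := by
  intro η hη
  refine ⟨0, ?_⟩
  filter_upwards [h.eventually_le_const (pos_iff_ne_zero.2 hη)] with n hn
  simpa using hn

/-- Once `c ≥ 2K`, the event `Y ≥ c` forces the excess `Y - K` to be at least `c / 2`. Markov
applied to the excess, whose integral is small, turns the usual `O(1/c)` tail into `o(1/c)`. -/
theorem tendsto_mul_meas_ge (h : AsympUnifIntegrable P Y) (hm : ∀ n, Measurable (Y n))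
    {c : ℕ → ℝ≥0} (hc : Tendsto c atTop atTop) :
    Tendsto (fun n => c n * P {ω | (c n : ℝ≥0∞) ≤ Y n ω}) atTop (𝓝 0) := by
  rw [ENNReal.tendsto_nhds_zero]
  intro η hη
  obtain ⟨K, hK⟩ := h (η / 2) (by simpa using hη.ne')
  filter_upwards [hK, hc.eventually_ge_atTop (2 * K)] with n h1 h2
  have hsub : {ω | (c n : ℝ≥0∞) ≤ Y n ω} ⊆ {ω | ((c n / 2 : ℝ≥0) : ℝ≥0∞) ≤ Y n ω - K} := by
    intro ω hω
    refine ENNReal.le_sub_of_add_le_right (by simp) (le_trans ?_ hω)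
    have : c n / 2 + K ≤ c n := by
      rw [← NNReal.coe_le_coe] at h2 ⊢
      push_cast at h2 ⊢
      linarith
    exact_mod_cast this
  calc (c n : ℝ≥0∞) * P {ω | (c n : ℝ≥0∞) ≤ Y n ω}
      ≤ c n * P {ω | ((c n / 2 : ℝ≥0) : ℝ≥0∞) ≤ Y n ω - K} := by gcongr
    _ = 2 * (((c n / 2 : ℝ≥0) : ℝ≥0∞) * P {ω | ((c n / 2 : ℝ≥0) : ℝ≥0∞) ≤ Y n ω - K}) := by
        rw [← mul_assoc]
        congr 1
        rw [show (2 : ℝ≥0∞) = ((2 : ℝ≥0) : ℝ≥0∞) by simp, ← ENNReal.coe_mul]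
        congr 1
        field_simp
    _ ≤ 2 * (η / 2) := by
        gcongr
        exact (mul_meas_ge_le_lintegral ((hm n).sub_const _) _).trans h1
    _ = η := ENNReal.mul_div_cancel (by simp) (by simp)

end AsympUnifIntegrable

end AsympUnifIntegrable

/-! ### Convergence in law and convergence of moments. -/

section moments

variable {Ω Ω' : Type*} [MeasurableSpace Ω] [MeasurableSpace Ω'] {P : Measure Ω} {Q : Measure Ω'}
  [IsProbabilityMeasure P] [IsProbabilityMeasure Q] {X : ℕ → Ω → ℝ} {Z : Ω' → ℝ}

theorem lintegral_min_add_lintegral_tsub {α : Type*} [MeasurableSpace α] {μ : Measure α}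
    {f : α → ℝ≥0∞} (hf : AEMeasurable f μ) (K : ℝ≥0∞) :
    ∫⁻ a, min (f a) K ∂μ + ∫⁻ a, (f a - K) ∂μ = ∫⁻ a, f a ∂μ := by
  rw [← lintegral_add_left' (hf.min aemeasurable_const)]
  refine lintegral_congr fun a => ?_
  rcases le_total (f a) K with h | h
  · simp [h, tsub_eq_zero_of_le h]
  · rw [min_eq_right h, add_tsub_cancel_of_le h]

theorem MeasureTheory.TendstoInDistribution.tendsto_lintegral_min
    (h : TendstoInDistribution X atTop Z (fun _ => P) Q) (K : ℝ≥0) :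
    Tendsto (fun n => ∫⁻ ω, min (ENNReal.ofReal (X n ω)) K ∂P) atTop
      (𝓝 (∫⁻ ω, min (ENNReal.ofReal (Z ω)) K ∂Q)) := by
  let f : BoundedContinuousFunction ℝ ℝ≥0 :=
    BoundedContinuousFunction.mkOfBound ⟨fun x => min x.toNNReal K, by fun_prop⟩ K fun x y => by
      rw [NNReal.dist_eq, abs_sub_le_iff]
      have h1 : ((min x.toNNReal K : ℝ≥0) : ℝ) ≤ K := by exact_mod_cast min_le_right _ _
      have h2 : ((min y.toNNReal K : ℝ≥0) : ℝ) ≤ K := by exact_mod_cast min_le_right _ _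
      have h3 : 0 ≤ ((min x.toNNReal K : ℝ≥0) : ℝ) := NNReal.coe_nonneg _
      have h4 : 0 ≤ ((min y.toNNReal K : ℝ≥0) : ℝ) := NNReal.coe_nonneg _
      simp only [ContinuousMap.coe_mk]
      constructor <;> linarith
  have hf : ∀ x, (f x : ℝ≥0∞) = min (ENNReal.ofReal x) K := fun x => by
    change ((min x.toNNReal K : ℝ≥0) : ℝ≥0∞) = _
    simp [ENNReal.ofReal]
  have := (ProbabilityMeasure.tendsto_iff_forall_lintegral_tendsto.1 h.tendsto) f
  simp_rw [hf] at this
  have hmeas : Measurable fun x : ℝ => min (ENNReal.ofReal x) (K : ℝ≥0∞) := by fun_prop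
  convert! this using 1
  · ext n
    exact (lintegral_map' hmeas.aemeasurable (h.forall_aemeasurable n)).symm
  · congr 1
    exact (lintegral_map' hmeas.aemeasurable h.aemeasurable_limit).symm

theorem tendsto_lintegral_min_natCast {α : Type*} [MeasurableSpace α] {μ : Measure α}
    {f : α → ℝ≥0∞} (hf : AEMeasurable f μ) (hfin : ∀ᵐ a ∂μ, f a ≠ ∞) :
    Tendsto (fun k : ℕ => ∫⁻ a, min (f a) ((k : ℝ≥0) : ℝ≥0∞) ∂μ) atTop (𝓝 (∫⁻ a, f a ∂μ)) := by
  refine lintegral_tendsto_of_tendsto_of_monotone (fun k => hf.min aemeasurable_const)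
    (ae_of_all _ fun a k l hkl => ?_) ?_
  · exact min_le_min le_rfl (by exact_mod_cast hkl)
  · filter_upwards [hfin] with a ha
    refine tendsto_const_nhds.congr' ?_
    obtain ⟨k, hk⟩ := ENNReal.exists_nat_gt ha
    filter_upwards [eventually_ge_atTop k] with l hl
    refine (min_eq_left (hk.le.trans ?_)).symm
    exact_mod_cast hl

/-- Truncated integrals converge, the truncation being bounded and continuous. The lower bound
follows by raising the truncation level; the upper bound because the discarded excess is uniformly
small. -/
theorem MeasureTheory.TendstoInDistribution.tendsto_lintegral
    (h : TendstoInDistribution X atTop Z (fun _ => P) Q)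
    (hX : AsympUnifIntegrable P (fun n ω => ENNReal.ofReal (X n ω))) :
    Tendsto (fun n => ∫⁻ ω, ENNReal.ofReal (X n ω) ∂P) atTop
      (𝓝 (∫⁻ ω, ENNReal.ofReal (Z ω) ∂Q)) := by
  refine tendsto_of_le_liminf_of_limsup_le ?_ ?_
  · refine le_of_tendsto' (tendsto_lintegral_min_natCast
      h.aemeasurable_limit.ennreal_ofReal (ae_of_all _ fun ω => by simp)) fun k => ?_
    rw [← (h.tendsto_lintegral_min k).liminf_eq]
    exact liminf_le_liminf (Eventually.of_forall fun n => lintegral_mono fun ω => min_le_left _ _)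
  · refine le_of_forall_gt_imp_ge_of_dense fun b hb => ?_
    have hη : b - ∫⁻ ω, ENNReal.ofReal (Z ω) ∂Q ≠ 0 := (tsub_pos_of_lt hb).ne'
    obtain ⟨K, hK⟩ := hX _ hη
    have h1 := (h.tendsto_lintegral_min K).add_const (b - ∫⁻ ω, ENNReal.ofReal (Z ω) ∂Q)
    have h2 : limsup (fun n => ∫⁻ ω, ENNReal.ofReal (X n ω) ∂P) atTop ≤
        ∫⁻ ω, min (ENNReal.ofReal (Z ω)) K ∂Q + (b - ∫⁻ ω, ENNReal.ofReal (Z ω) ∂Q) := by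
      rw [← h1.limsup_eq]
      refine limsup_le_limsup ?_
      filter_upwards [hK] with n hn
      rw [← lintegral_min_add_lintegral_tsub (h.forall_aemeasurable n).ennreal_ofReal K]
      gcongr
    refine h2.trans ?_
    calc _ ≤ ∫⁻ ω, ENNReal.ofReal (Z ω) ∂Q + (b - ∫⁻ ω, ENNReal.ofReal (Z ω) ∂Q) := by
          gcongr; exact min_le_left _ _
      _ = b := add_tsub_cancel_of_le hb.le

/-- Converse direction: the excess over `k` is the full integral minus the truncated one. Both
converge, so the excess tends to that of the limit variable, which is small for large `k`. -/
theorem MeasureTheory.TendstoInDistribution.asympUnifIntegrable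
    (h : TendstoInDistribution X atTop Z (fun _ => P) Q)
    (hZ : ∫⁻ ω, ENNReal.ofReal (Z ω) ∂Q ≠ ∞)
    (hlim : Tendsto (fun n => ∫⁻ ω, ENNReal.ofReal (X n ω) ∂P) atTop
      (𝓝 (∫⁻ ω, ENNReal.ofReal (Z ω) ∂Q))) :
    AsympUnifIntegrable P (fun n ω => ENNReal.ofReal (X n ω)) := by
  intro η hη
  have hsub : ∀ (K : ℝ≥0), ∫⁻ ω, (ENNReal.ofReal (Z ω) - K) ∂Q
      = ∫⁻ ω, ENNReal.ofReal (Z ω) ∂Q - ∫⁻ ω, min (ENNReal.ofReal (Z ω)) K ∂Q := fun K => by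
    rw [← lintegral_min_add_lintegral_tsub h.aemeasurable_limit.ennreal_ofReal K]
    exact (ENNReal.add_sub_cancel_left (ne_top_of_le_ne_top hZ
      (lintegral_mono fun a => min_le_left _ _))).symm
  have h0 := ENNReal.Tendsto.sub (tendsto_const_nhds (x := ∫⁻ ω, ENNReal.ofReal (Z ω) ∂Q))
    (tendsto_lintegral_min_natCast h.aemeasurable_limit.ennreal_ofReal
      (ae_of_all Q fun ω => by simp)) (Or.inl hZ)
  rw [tsub_self] at h0
  obtain ⟨k, hk⟩ := (h0.eventually_lt_const (pos_iff_ne_zero.2 hη)).exists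
  have h1 := ENNReal.Tendsto.sub hlim (h.tendsto_lintegral_min k) (Or.inl hZ)
  refine ⟨k, ?_⟩
  filter_upwards [h1.eventually_lt_const hk] with n hn
  refine le_of_eq_of_le ?_ hn.le
  rw [← lintegral_min_add_lintegral_tsub (h.forall_aemeasurable n).ennreal_ofReal (k : ℝ≥0)]
  refine (ENNReal.add_sub_cancel_left (ne_top_of_le_ne_top (b := ∫⁻ _, ((k : ℝ≥0) : ℝ≥0∞) ∂P)
    (by simp) (lintegral_mono fun a => min_le_right _ _))).symm

theorem MeasureTheory.TendstoInDistribution.tendsto_integral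
    (h : TendstoInDistribution X atTop Z (fun _ => P) Q)
    (hX : AsympUnifIntegrable P (fun n ω => ENNReal.ofReal (X n ω)))
    (hXi : ∀ n, Integrable (X n) P) (hX0 : ∀ n ω, 0 ≤ X n ω)
    (hZi : Integrable Z Q) (hZ0 : ∀ ω, 0 ≤ Z ω) :
    Tendsto (fun n => ∫ ω, X n ω ∂P) atTop (𝓝 (∫ ω, Z ω ∂Q)) := by
  have := h.tendsto_lintegral hX
  simp_rw [← ofReal_integral_eq_lintegral_ofReal (hXi _) (ae_of_all _ (hX0 _)),
    ← ofReal_integral_eq_lintegral_ofReal hZi (ae_of_all _ hZ0)] at this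
  have h2 := (ENNReal.tendsto_toReal (by simp)).comp this
  have e1 : ∀ n, 0 ≤ ∫ ω, X n ω ∂P := fun n => integral_nonneg (hX0 n)
  have e2 : 0 ≤ ∫ ω, Z ω ∂Q := integral_nonneg hZ0
  simpa [Function.comp_def, ENNReal.toReal_ofReal, e1, e2] using h2

/-- The exact fourth moment `E X⁴ / n + 3 (1 - 1/n) (E X²)²` tends to `3 v²`, the fourth moment of
the Gaussian limit, so the converse above applies. -/
theorem asympUnifIntegrable_normalized_sum_pow_four (hm : ∀ i, Measurable (X i))
    (hind : iIndepFun X P) (hid : ∀ i, IdentDistrib (X i) (X 0) P P) (h4 : MemLp (X 0) 4 P)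
    (h0 : ∫ ω, X 0 ω ∂P = 0) :
    AsympUnifIntegrable P
      (fun n ω => ENNReal.ofReal (((√n)⁻¹ * ∑ i ∈ Finset.range n, X i ω) ^ 4)) := by
  have h2 : MemLp (X 0) 2 P := h4.mono_exponent (by norm_num)
  set v : ℝ≥0 := Var[X 0; P].toNNReal with hv
  have hvm : (v : ℝ) = ∫ ω, X 0 ω ^ 2 ∂P := by
    rw [hv, Real.coe_toNNReal _ (variance_nonneg _ _), variance_eq_sub h2, h0]
    simp
  have hclt := tendstoInDistribution_inv_sqrt_mul_sum_sub (Y := fun x : ℝ => x)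
    (P' := gaussianReal 0 v) ⟨by fun_prop, Measure.map_id⟩ h2 hind hid
  rw [h0] at hclt
  simp only [mul_zero, sub_zero] at hclt
  have h := hclt.continuous_comp (g := fun x : ℝ => x ^ 4) (by fun_prop)
  have hZi : Integrable (fun x : ℝ => x ^ 4) (gaussianReal 0 v) :=
    (memLp_pow_gaussianReal 4 1 v).integrable (by simp)
  refine h.asympUnifIntegrable ?_ ?_
  · change ∫⁻ x : ℝ, ENNReal.ofReal (x ^ 4) ∂gaussianReal 0 v ≠ ∞
    rw [← ofReal_integral_eq_lintegral_ofReal hZi (ae_of_all _ fun x => by positivity)]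
    simp
  · change Tendsto (fun n : ℕ => ∫⁻ ω, ENNReal.ofReal
      (((√n)⁻¹ * ∑ i ∈ Finset.range n, X i ω) ^ 4) ∂P) atTop
        (𝓝 (∫⁻ x : ℝ, ENNReal.ofReal (x ^ 4) ∂gaussianReal 0 v))
    have hi (n : ℕ) : Integrable
        (fun ω => ((√n)⁻¹ * ∑ i ∈ Finset.range n, X i ω) ^ 4) P :=
      MemLp.integrable_pow_of_le (m := 4) ((memLp_iid_sum hid h4 n).const_mul _) le_rfl
    rw [← ofReal_integral_eq_lintegral_ofReal hZi (ae_of_all _ fun x => by positivity)]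
    simp_rw [← fun n => ofReal_integral_eq_lintegral_ofReal (hi n)
      (ae_of_all _ fun x => by positivity)]
    refine ENNReal.tendsto_ofReal ?_
    rw [integral_pow_four_gaussianReal]
    have hn : Tendsto (fun n : ℕ => (n : ℝ)⁻¹) atTop (𝓝 0) := tendsto_inv_atTop_nhds_zero_nat
    have := (hn.mul_const (∫ ω, X 0 ω ^ 4 ∂P)).add
      (((hn.const_sub 1).const_mul 3).mul_const ((∫ ω, X 0 ω ^ 2 ∂P) ^ 2))
    rw [hvm]
    simp only [zero_mul, sub_zero, mul_one, zero_add] at this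
    refine this.congr' ?_
    filter_upwards [eventually_gt_atTop 0] with n hn0
    rw [integral_normalized_sum_pow_four hm hind hid h4 h0 hn0]

end moments

/-! ### Singular values and weighted second-moment matrices. -/

section linearAlgebra

variable {d : ℕ}

theorem exists_orthonormalBasis_singularValue {U : Matrix (Fin d) (Fin d) ℝ}
    (hU : (Matrix.toEuclideanLin U).IsPositive) :
    ∃ b : OrthonormalBasis (Fin d) ℝ (EuclideanSpace ℝ (Fin d)),
      ∀ j, Matrix.toEuclideanLin U (b j) = matrixSingularValue U j • b j := by
  set T := Matrix.toEuclideanLin U with hT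
  have hn : Module.finrank ℝ (EuclideanSpace ℝ (Fin d)) = d := finrank_euclideanSpace_fin
  have hs := T.isSymmetric_adjoint_comp_self
  refine ⟨hs.eigenvectorBasis hn, fun j => ?_⟩
  have hsing : matrixSingularValue U j ^ 2 = hs.eigenvalues hn j := T.sq_singularValues_fin hn j
  have hnn : 0 ≤ matrixSingularValue U j := T.singularValues_nonneg j
  have hb := hs.apply_eigenvectorBasis hn j
  rw [← hsing] at hb
  set σ := matrixSingularValue U j
  set v := hs.eigenvectorBasis hn j
  have hTT : T (T v) = σ ^ 2 • v := by
    have : LinearMap.adjoint T = T := (LinearMap.isSymmetric_iff_isSelfAdjoint T).1 hU.isSymmetric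
    rw [this] at hb
    exact hb
  rcases hnn.eq_or_lt with h0 | h0
  · rw [← h0] at hTT ⊢
    have : inner ℝ (T v) (T v) = 0 := by
      rw [hU.isSymmetric v (T v), hTT]; simp
    simpa using this
  -- From `(T + σ)(T - σ) v = 0` the vector `w` satisfies `T w = -σ w`; positivity of `T` and `σ >
  -- 0` leave only `w = 0`.
  · set w := T v - σ • v with hw
    have hTw : T w = -(σ • w) := by
      rw [hw, map_sub, map_smul, hTT]
      module
    have h1 : 0 ≤ inner ℝ (T w) w := hU.2 w
    rw [hTw, inner_neg_left, inner_smul_left] at h1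
    have h2 : inner ℝ w w = (0 : ℝ) := by
      have h3 : (0 : ℝ) ≤ inner ℝ w w := real_inner_self_nonneg
      simp only [conj_trivial] at h1
      nlinarith [mul_nonneg h0.le h3]
    exact sub_eq_zero.1 (inner_self_eq_zero.1 h2)

/-- For symmetric `U` the sum of squared entries is `tr (U²)`, which is computed in the eigenbasis.
-/
theorem frobeniusNorm_sq_eq_sum {U : Matrix (Fin d) (Fin d) ℝ}
    (hU : (Matrix.toEuclideanLin U).IsPositive) :
    frobeniusNorm U ^ 2 = ∑ j, matrixSingularValue U j ^ 2 := by
  obtain ⟨b, hb⟩ := exists_orthonormalBasis_singularValue hU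
  have h1 : frobeniusNorm U ^ 2 = ∑ i, ∑ j, U i j ^ 2 := by
    unfold frobeniusNorm
    rw [Matrix.frobenius_norm_def, ← Real.sqrt_eq_rpow, Real.sq_sqrt (by positivity)]
    simp
  have hsym : U.transpose = U := by
    have := (Matrix.isSymmetric_toEuclideanLin_iff.1 hU.isSymmetric)
    simpa [Matrix.IsHermitian] using this
  have h2 : ∑ i, ∑ j, U i j ^ 2 = (U * U).trace := by
    simp only [Matrix.trace, Matrix.diag, Matrix.mul_apply]
    refine Finset.sum_congr rfl fun i _ => Finset.sum_congr rfl fun j _ => ?_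
    rw [← congrFun (congrFun hsym i) j, Matrix.transpose_apply, sq]
  have h3 : (U * U).trace = (Matrix.toEuclideanLin (U * U)).trace ℝ _ := by
    rw [Matrix.toEuclideanLin_eq_toLin_orthonormal, Matrix.trace_toLin_eq]
  rw [h1, h2, h3, LinearMap.trace_eq_sum_inner _ b]
  refine Finset.sum_congr rfl fun j _ => ?_
  rw [Matrix.toLpLin_mul 2 2 2, LinearMap.comp_apply, hb, map_smul, hb, smul_smul, inner_smul_right]
  simp [sq]

variable {Ω : Type*} [MeasurableSpace Ω] {P : Measure Ω} {X : Ω → EuclideanSpace ℝ (Fin d)}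

theorem integrable_weight_mul_coord (hX : Measurable X) {w : Ω → ℝ}
    (hw : Measurable w) (hint : Integrable (fun ω => w ω * ‖X ω‖ ^ 2) P) (i j : Fin d) :
    Integrable (fun ω => w ω * (X ω i * X ω j)) P := by
  refine hint.mono (by fun_prop) (ae_of_all _ fun ω => ?_)
  rw [norm_mul, norm_mul, norm_mul, norm_pow, norm_norm, sq]
  gcongr
  · exact PiLp.norm_apply_le (X ω) i
  · exact PiLp.norm_apply_le (X ω) j

/-- The quadratic form of a weighted second-moment matrix. -/
theorem inner_toEuclideanLin_integral (hX : Measurable X) {w : Ω → ℝ}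
    (hw : Measurable w) (hint : Integrable (fun ω => w ω * ‖X ω‖ ^ 2) P)
    {M : Matrix (Fin d) (Fin d) ℝ} (hM : ∀ i j, M i j = ∫ ω, w ω * (X ω i * X ω j) ∂P)
    (u : EuclideanSpace ℝ (Fin d)) :
    inner ℝ u (Matrix.toEuclideanLin M u) = ∫ ω, w ω * inner ℝ u (X ω) ^ 2 ∂P := by
  have e : ∀ ω, w ω * inner ℝ u (X ω) ^ 2
      = ∑ i, ∑ j, u i * u j * (w ω * (X ω i * X ω j)) := fun ω => by
    rw [sq, PiLp.inner_apply, Finset.sum_mul_sum, Finset.mul_sum]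
    refine Finset.sum_congr rfl fun i _ => ?_
    rw [Finset.mul_sum]
    refine Finset.sum_congr rfl fun j _ => ?_
    simp
    ring
  simp_rw [e]
  rw [integral_finsetSum _ fun i _ => integrable_finsetSum _ fun j _ =>
    (integrable_weight_mul_coord hX hw hint i j).const_mul _]
  rw [PiLp.inner_apply]
  refine Finset.sum_congr rfl fun i _ => ?_
  rw [integral_finsetSum _ fun j _ =>
    (integrable_weight_mul_coord hX hw hint i j).const_mul _]
  simp only [Matrix.toLpLin_apply, Matrix.mulVec, dotProduct, RCLike.inner_apply, conj_trivial,
    Finset.sum_mul]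
  refine Finset.sum_congr rfl fun j _ => ?_
  rw [integral_const_mul, hM]
  ring

theorem isSymmetric_toEuclideanLin_integral {w : Ω → ℝ}
    {M : Matrix (Fin d) (Fin d) ℝ} (hM : ∀ i j, M i j = ∫ ω, w ω * (X ω i * X ω j) ∂P) :
    M.IsHermitian := by
  ext i j
  simp [hM, mul_comm (X _ i)]

theorem isPositive_toEuclideanLin_integral (hX : Measurable X) {w : Ω → ℝ} (hw0 : ∀ ω, 0 ≤ w ω)
    (hw : Measurable w) (hint : Integrable (fun ω => w ω * ‖X ω‖ ^ 2) P)
    {M : Matrix (Fin d) (Fin d) ℝ} (hM : ∀ i j, M i j = ∫ ω, w ω * (X ω i * X ω j) ∂P) :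
    (Matrix.toEuclideanLin M).IsPositive := by
  refine ⟨Matrix.isSymmetric_toEuclideanLin_iff.2 (isSymmetric_toEuclideanLin_integral hM),
    fun u => ?_⟩
  rw [real_inner_comm, inner_toEuclideanLin_integral hX hw hint hM]
  exact integral_nonneg fun ω => mul_nonneg (hw0 ω) (sq_nonneg _)

theorem norm_sq_toEuclideanLin_sqrt {V : Matrix (Fin d) (Fin d) ℝ} (hV : 0 ≤ V)
    (u : EuclideanSpace ℝ (Fin d)) :
    ‖Matrix.toEuclideanLin (CFC.sqrt V) u‖ ^ 2 = inner ℝ u (Matrix.toEuclideanLin V u) := by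
  have hs : (Matrix.toEuclideanLin (CFC.sqrt V)).IsSymmetric :=
    Matrix.isSymmetric_toEuclideanLin_iff.2
      (Matrix.nonneg_iff_posSemidef.1 (CFC.sqrt_nonneg V)).isHermitian
  rw [← real_inner_self_eq_norm_sq, hs, ← LinearMap.comp_apply, ← Matrix.toLpLin_mul 2 2 2,
    CFC.sqrt_mul_sqrt_self V hV]

theorem predictionMSE_eq_norm_sq (hX : Measurable X) (hV : MemLp X 2 P)
    (θ₀ θ : EuclideanSpace ℝ (Fin d)) :
    predictionMSE P X θ₀ θ
      = ‖Matrix.toEuclideanLin (CFC.sqrt (covariateMatrix P X)) (θ - θ₀)‖ ^ 2 := by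
  have hint : Integrable (fun ω => (1 : ℝ) * ‖X ω‖ ^ 2) P := by
    simpa using hV.integrable_norm_pow (by simp)
  have hM : ∀ i j, covariateMatrix P X i j = ∫ ω, (1 : ℝ) * (X ω i * X ω j) ∂P := by
    simp [covariateMatrix]
  have hpos := isPositive_toEuclideanLin_integral hX (fun _ => zero_le_one) measurable_const hint hM
  rw [norm_sq_toEuclideanLin_sqrt
    (Matrix.nonneg_iff_posSemidef.2 (Matrix.isPositive_toEuclideanLin_iff.1 hpos)),
    inner_toEuclideanLin_integral hX measurable_const hint hM, predictionMSE]
  refine integral_congr_ae (ae_of_all _ fun ω => ?_)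
  simp [inner_sub_left]

end linearAlgebra

/-! ### Perturbation of an invertible linear map. -/

section perturbation

variable {E : Type*} [NormedAddCommGroup E] [NormedSpace ℝ E]
  {J J' K : E →ₗ[ℝ] E} {κ δ : ℝ}

/-- `‖v‖ ≤ κ ‖J v‖ ≤ κ ‖J' v‖ + κ δ ‖v‖`, and the last term is absorbed since `κ δ ≤ 1/2`. -/
theorem norm_le_of_perturbed_inverse (hKJ : ∀ v, K (J v) = v) (hK : ∀ v, ‖K v‖ ≤ κ * ‖v‖)
    (hκ : 0 ≤ κ) (hδ : ∀ v, ‖J' v - J v‖ ≤ δ * ‖v‖) (h : κ * δ ≤ 1 / 2) (v : E) :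
    ‖v‖ ≤ 2 * κ * ‖J' v‖ := by
  have h1 : ‖v‖ ≤ κ * ‖J v‖ := by simpa [hKJ] using hK (J v)
  have h2 : ‖J v‖ ≤ ‖J' v‖ + δ * ‖v‖ := by
    calc ‖J v‖ = ‖J' v - (J' v - J v)‖ := by rw [sub_sub_cancel]
      _ ≤ ‖J' v‖ + ‖J' v - J v‖ := norm_sub_le _ _
      _ ≤ _ := by gcongr; exact hδ v
  nlinarith [mul_le_mul_of_nonneg_left h2 hκ, mul_le_mul_of_nonneg_right h (norm_nonneg v)]

theorem surjective_of_perturbed_inverse [FiniteDimensional ℝ E] (hKJ : ∀ v, K (J v) = v)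
    (hK : ∀ v, ‖K v‖ ≤ κ * ‖v‖) (hκ : 0 ≤ κ) (hδ : ∀ v, ‖J' v - J v‖ ≤ δ * ‖v‖)
    (h : κ * δ ≤ 1 / 2) : Function.Surjective J' := by
  rw [← LinearMap.injective_iff_surjective, injective_iff_map_eq_zero]
  intro v hv
  simpa [hv] using norm_le_of_perturbed_inverse hKJ hK hκ hδ h v

theorem norm_sub_le_of_perturbed_inverse (hKJ : ∀ v, K (J v) = v) (hK : ∀ v, ‖K v‖ ≤ κ * ‖v‖)
    (hκ : 0 ≤ κ) (hδ0 : 0 ≤ δ) (hδ : ∀ v, ‖J' v - J v‖ ≤ δ * ‖v‖) (h : κ * δ ≤ 1 / 2)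
    {v y r : E} (hv : J' v = y - r) :
    ‖v - K y‖ ≤ κ * ‖r‖ + 2 * κ ^ 2 * δ * (‖y‖ + ‖r‖) := by
  -- The linearization error is exactly `-K (r + (J' - J) v)`; the a priori bound on `v` controls
  -- the second term.
  have e : v - K y = -K (r + (J' v - J v)) := by
    rw [hv, show r + (y - r - J v) = y - J v by abel, map_sub, hKJ, neg_sub]
  have h1 := norm_le_of_perturbed_inverse hKJ hK hκ hδ h v
  rw [hv] at h1
  have h2 : ‖r + (J' v - J v)‖ ≤ ‖r‖ + δ * (2 * κ * (‖y‖ + ‖r‖)) := by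
    refine (norm_add_le _ _).trans ?_
    gcongr
    refine (hδ v).trans ?_
    gcongr
    refine h1.trans ?_
    gcongr
    exact norm_sub_le _ _
  rw [e, norm_neg]
  calc _ ≤ κ * ‖r + (J' v - J v)‖ := hK _
    _ ≤ κ * (‖r‖ + δ * (2 * κ * (‖y‖ + ‖r‖))) := by gcongr
    _ = _ := by ring

theorem EuclideanSpace.norm_le_sum_abs {d : ℕ} (w : EuclideanSpace ℝ (Fin d)) :
    ‖w‖ ≤ ∑ i, |w i| := by
  rw [EuclideanSpace.norm_eq]
  refine Real.sqrt_le_iff.2 ⟨by positivity, ?_⟩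
  simp_rw [Real.norm_eq_abs]
  exact Finset.sum_sq_le_sq_sum_of_nonneg fun i _ => abs_nonneg _

theorem norm_toEuclideanLin_le_sum {d : ℕ} (M : Matrix (Fin d) (Fin d) ℝ)
    (v : EuclideanSpace ℝ (Fin d)) :
    ‖Matrix.toEuclideanLin M v‖ ≤ (∑ i, ∑ j, |M i j|) * ‖v‖ := by
  refine (EuclideanSpace.norm_le_sum_abs _).trans ?_
  rw [Finset.sum_mul]
  refine Finset.sum_le_sum fun i _ => ?_
  rw [Matrix.toLpLin_apply]
  simp only [Matrix.mulVec, dotProduct]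
  refine (Finset.abs_sum_le_sum_abs _ _).trans ?_
  rw [Finset.sum_mul]
  refine Finset.sum_le_sum fun j _ => ?_
  rw [abs_mul]
  gcongr
  exact PiLp.norm_apply_le v j

end perturbation

/-! ### Multivariate central limit theorem. -/

section vectorCLT

variable {d : ℕ}

theorem measurable_toLp_const_mul (c : Fin d → ℝ) :
    Measurable fun ξ : Fin d → ℝ => (WithLp.toLp 2 fun j => c j * ξ j : EuclideanSpace ℝ (Fin d)) :=
  (WithLp.measurable_toLp 2 _).comp (by fun_prop)

theorem charFun_map_pi_gaussianReal (lam : Fin d → ℝ) (hlam : ∀ j, 0 ≤ lam j)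
    (t : EuclideanSpace ℝ (Fin d)) :
    charFun ((Measure.pi fun _ : Fin d => gaussianReal 0 1).map
      (fun ξ => WithLp.toLp 2 fun j => √(lam j) * ξ j)) t
      = Complex.exp (-((∑ j, lam j * t j ^ 2 : ℝ) : ℂ) / 2) := by
  have h1 := charFun_pi (μ := fun _ : Fin d => gaussianReal 0 1)
    (WithLp.toLp 2 fun j => √(lam j) * t j)
  have h2 : charFun ((Measure.pi fun _ : Fin d => gaussianReal 0 1).map
      (fun ξ => (WithLp.toLp 2 fun j => √(lam j) * ξ j : EuclideanSpace ℝ (Fin d)))) t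
      -- The diagonal scaling is symmetric, so it moves from `ξ` to the argument `t`, leaving a
      -- product of standard characteristic functions.
      = charFun ((Measure.pi fun _ : Fin d => gaussianReal 0 1).map (WithLp.toLp 2))
        (WithLp.toLp 2 fun j => √(lam j) * t j : EuclideanSpace ℝ (Fin d)) := by
    rw [charFun_apply, charFun_apply,
      integral_map (measurable_toLp_const_mul _).aemeasurable (by fun_prop),
      integral_map (by fun_prop) (by fun_prop)]
    refine integral_congr_ae (ae_of_all _ fun ξ => ?_)
    simp only [PiLp.inner_apply]
    congr 3
    refine Finset.sum_congr rfl fun j _ => ?_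
    simp
    ring
  rw [h2, h1]
  simp_rw [charFun_gaussianReal]
  rw [← Complex.exp_sum]
  congr 1
  push_cast
  rw [← Finset.sum_neg_distrib, Finset.sum_div]
  refine Finset.sum_congr rfl fun j _ => ?_
  have : ((√(lam j) : ℝ) : ℂ) ^ 2 = lam j := by
    rw [← Complex.ofReal_pow, Real.sq_sqrt (hlam j)]
  simp [mul_pow, this]
  ring

variable {Ω : Type*} [MeasurableSpace Ω] {P : Measure Ω} [IsProbabilityMeasure P]

/-- A multivariate central limit theorem with diagonal limiting covariance. -/
theorem tendstoInDistribution_normalized_sum_diagonal {ψ : ℕ → Ω → EuclideanSpace ℝ (Fin d)}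
    (hm : ∀ i, Measurable (ψ i)) (hind : iIndepFun ψ P)
    (hid : ∀ i, IdentDistrib (ψ i) (ψ 0) P P) (h2 : MemLp (ψ 0) 2 P)
    (h0 : ∀ t, ∫ ω, inner ℝ (ψ 0 ω) t ∂P = 0) (lam : Fin d → ℝ) (hlam : ∀ j, 0 ≤ lam j)
    (hcov : ∀ t : EuclideanSpace ℝ (Fin d),
      ∫ ω, inner ℝ (ψ 0 ω) t ^ 2 ∂P = ∑ j, lam j * t j ^ 2) :
    TendstoInDistribution (fun (n : ℕ) ω => (√n)⁻¹ • ∑ i ∈ Finset.range n, ψ i ω) atTop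
      (fun ξ => (WithLp.toLp 2 fun j => √(lam j) * ξ j : EuclideanSpace ℝ (Fin d)))
      (fun _ => P) (Measure.pi fun _ : Fin d => gaussianReal 0 1) where
  forall_aemeasurable n := by fun_prop
  aemeasurable_limit := (measurable_toLp_const_mul _).aemeasurable
  tendsto := by
    refine ProbabilityMeasure.tendsto_iff_tendsto_charFun.2 fun t => ?_
    have hmt : Measurable fun x : EuclideanSpace ℝ (Fin d) => (inner ℝ x t : ℝ) := by fun_prop
    have h2t : MemLp (fun ω => (inner ℝ (ψ 0 ω) t : ℝ)) 2 P := by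
      refine (h2.norm.mul_const ‖t‖).mono (by fun_prop) (ae_of_all _ fun ω => ?_)
      simpa using norm_inner_le_norm (𝕜 := ℝ) (ψ 0 ω) t
    set v : ℝ≥0 := Var[fun ω => (inner ℝ (ψ 0 ω) t : ℝ); P].toNNReal with hv
    have hvm : (v : ℝ) = ∑ j, lam j * t j ^ 2 := by
      rw [hv, Real.coe_toNNReal _ (variance_nonneg _ _), variance_eq_sub h2t, h0, ← hcov]
      simp
    have hclt := tendstoInDistribution_inv_sqrt_mul_sum_sub
      (X := fun i ω => (inner ℝ (ψ i ω) t : ℝ)) (Y := fun x : ℝ => x)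
      (P' := gaussianReal 0 v) ⟨by fun_prop, Measure.map_id⟩ h2t
      (hind.comp (fun _ x => (inner ℝ x t : ℝ)) fun _ => hmt) fun i => (hid i).comp hmt
    rw [h0] at hclt
    simp only [mul_zero, sub_zero] at hclt
    -- Cramér–Wold: the vector characteristic function at `t` is that of the projection onto `t` at
    -- the argument `1`.
    have h := ProbabilityMeasure.tendsto_iff_tendsto_charFun.1 hclt.tendsto 1
    simp only [ProbabilityMeasure.coe_mk] at h ⊢
    rw [charFun_map_pi_gaussianReal lam hlam, ← hvm]
    rw [show Measure.map (fun x : ℝ => x) (gaussianReal 0 v) = gaussianReal 0 v from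
      Measure.map_id, charFun_gaussianReal] at h
    convert! h using 1
    · ext n
      rw [charFun_apply, charFun_apply, integral_map (by fun_prop) (by fun_prop),
        integral_map (by fun_prop) (by fun_prop)]
      refine integral_congr_ae (ae_of_all _ fun ω => ?_)
      simp [inner_smul_left, sum_inner]
    · simp [neg_div]

end vectorCLT

/-! ### Sums depending on independent auxiliary data. -/

section nuisance

variable {Ω 𝒲 𝒪 : Type*} [MeasurableSpace Ω] [MeasurableSpace 𝒲] [MeasurableSpace 𝒪]
  {P : Measure Ω} [IsProbabilityMeasure P]

theorem lintegral_comp_prodMk_of_indepFun {W : Ω → 𝒲} {O : Ω → 𝒪} (hW : Measurable W)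
    (hO : Measurable O) (h : IndepFun W O P) {F : 𝒲 × 𝒪 → ℝ≥0∞} (hF : Measurable F) :
    ∫⁻ ω, F (W ω, O ω) ∂P = ∫⁻ ω', ∫⁻ ω, F (W ω', O ω) ∂P ∂P := by
  have h1 := (indepFun_iff_map_prod_eq_prod_map_map hW.aemeasurable hO.aemeasurable).1 h
  have : IsProbabilityMeasure (P.map O) := Measure.isProbabilityMeasure_map hO.aemeasurable
  rw [← lintegral_map hF (hW.prodMk hO), h1, lintegral_prod _ hF.aemeasurable,
    lintegral_map hF.lintegral_prod_right' hW]
  refine lintegral_congr fun ω' => ?_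
  rw [lintegral_map (by fun_prop) hO]

variable {W : Ω → 𝒲} {O : ℕ → Ω → 𝒪} {g : 𝒲 × 𝒪 → ℝ} {n : ℕ}

/-- Independence and Fubini allow `W` to be frozen at `w`; the bound for fixed `w` is then
integrated over the law of `W`. Positivity of `n` ensures that observation `0` belongs to the sample
independent of `W`. -/
theorem lintegral_enorm_pow_normalized_sum_indep (p : ℕ) (hW : Measurable W)
    (hO : ∀ i, Measurable (O i)) (hWO : IndepFun W (fun ω (i : Fin n) => O i ω) P)
    (hg : Measurable g) (hn : 0 < n) {C : ℝ≥0∞}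
    (hbound : ∀ w, ∫⁻ ω, ‖(√n)⁻¹ * ∑ i ∈ Finset.range n, g (w, O i ω)‖ₑ ^ p ∂P
      ≤ C * ∫⁻ ω, ‖g (w, O 0 ω)‖ₑ ^ p ∂P) :
    ∫⁻ ω, ‖(√n)⁻¹ * ∑ i ∈ Finset.range n, g (W ω, O i ω)‖ₑ ^ p ∂P
      ≤ C * ∫⁻ ω, ‖g (W ω, O 0 ω)‖ₑ ^ p ∂P := by
  have hOn : Measurable (fun ω (i : Fin n) => O i ω) := by fun_prop
  have h0 : IndepFun W (O 0) P :=
    hWO.comp measurable_id (measurable_pi_apply (⟨0, hn⟩ : Fin n))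
  have e1 := lintegral_comp_prodMk_of_indepFun hW hOn hWO
    (F := fun q : 𝒲 × (Fin n → 𝒪) => ‖(√n)⁻¹ * ∑ i : Fin n, g (q.1, q.2 i)‖ₑ ^ p) (by fun_prop)
  have e2 := lintegral_comp_prodMk_of_indepFun hW (hO 0) h0
    (F := fun q : 𝒲 × 𝒪 => ‖g q‖ₑ ^ p) (by fun_prop)
  have hs : ∀ w ω, ∑ i : Fin n, g (w, O i ω) = ∑ i ∈ Finset.range n, g (w, O i ω) := fun w ω =>
    Fin.sum_univ_eq_sum_range (fun i => g (w, O i ω)) n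
  simp only [hs] at e1
  rw [e1, e2, ← lintegral_const_mul]
  · exact lintegral_mono fun ω' => hbound (W ω')
  · exact (Measurable.lintegral_prod_right' (f := fun q : Ω × Ω => ‖g (W q.1, O 0 q.2)‖ₑ ^ p)
      (by fun_prop))

theorem lintegral_enorm_normalized_sum_sq_le_of_indep (hW : Measurable W)
    (hO : ∀ i, Measurable (O i)) (hind : iIndepFun O P)
    (hid : ∀ i, IdentDistrib (O i) (O 0) P P)
    (hWO : IndepFun W (fun ω (i : Fin n) => O i ω) P) (hg : Measurable g) (hn : 0 < n)
    (h0 : ∀ w, Integrable (fun ω => g (w, O 0 ω)) P → ∫ ω, g (w, O 0 ω) ∂P = 0) :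
    ∫⁻ ω, ‖(√n)⁻¹ * ∑ i ∈ Finset.range n, g (W ω, O i ω)‖ₑ ^ 2 ∂P
      ≤ ∫⁻ ω, ‖g (W ω, O 0 ω)‖ₑ ^ 2 ∂P := by
  have := lintegral_enorm_pow_normalized_sum_indep (C := 1) 2 hW hO hWO hg hn fun w => by
    have hgw : Measurable fun o => g (w, o) := by fun_prop
    rw [one_mul]
    exact lintegral_enorm_normalized_sum_sq_le (X := fun i ω => g (w, O i ω)) (by fun_prop)
      (hind.comp (fun _ o => g (w, o)) fun _ => hgw) (fun i => (hid i).comp hgw) (h0 w) n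
  rwa [one_mul] at this

theorem lintegral_enorm_normalized_sum_pow_four_le_of_indep (hW : Measurable W)
    (hO : ∀ i, Measurable (O i)) (hind : iIndepFun O P)
    (hid : ∀ i, IdentDistrib (O i) (O 0) P P)
    (hWO : IndepFun W (fun ω (i : Fin n) => O i ω) P) (hg : Measurable g) (hn : 0 < n)
    (h0 : ∀ w, Integrable (fun ω => g (w, O 0 ω)) P → ∫ ω, g (w, O 0 ω) ∂P = 0) :
    ∫⁻ ω, ‖(√n)⁻¹ * ∑ i ∈ Finset.range n, g (W ω, O i ω)‖ₑ ^ 4 ∂P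
      ≤ 3 * ∫⁻ ω, ‖g (W ω, O 0 ω)‖ₑ ^ 4 ∂P :=
  lintegral_enorm_pow_normalized_sum_indep 4 hW hO hWO hg hn fun w => by
    have hgw : Measurable fun o => g (w, o) := by fun_prop
    exact lintegral_enorm_normalized_sum_pow_four_le (X := fun i ω => g (w, O i ω)) (by fun_prop)
      (hind.comp (fun _ o => g (w, o)) fun _ => hgw) (fun i => (hid i).comp hgw) (h0 w) n

end nuisance

/-! ### Centring by conditional expectations and Vitali convergence. -/

section condExp

variable {Ω β : Type*} [mΩ : MeasurableSpace Ω] [MeasurableSpace β] {P : Measure Ω}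
  [IsProbabilityMeasure P]

theorem integral_mul_comp_eq_zero_of_condExp_eq_zero {e : Ω → ℝ} {B : Ω → β} (hB : Measurable B)
    (he : Integrable e P) (hce : P[e | MeasurableSpace.comap B inferInstance] =ᵐ[P] 0) {h : β → ℝ}
    (hh : Measurable h) (hint : Integrable (fun ω => e ω * h (B ω)) P) :
    ∫ ω, e ω * h (B ω) ∂P = 0 := by
  have hle : MeasurableSpace.comap B inferInstance ≤ mΩ := hB.comap_le
  have hsm : StronglyMeasurable[MeasurableSpace.comap B inferInstance] fun ω => h (B ω) :=
    (hh.comp (comap_measurable B)).stronglyMeasurable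
  rw [← integral_condExp hle]
  have h1 := condExp_mul_of_stronglyMeasurable_right hsm hint he
  refine (integral_congr_ae (h1.trans ?_)).trans (integral_zero _ _)
  filter_upwards [hce] with ω hω
  simp [hω]

/-- Convergence in probability to zero is preserved by multiplication with a fixed variable. -/
theorem tendstoInMeasure_mul_fixed {f : ℕ → Ω → ℝ} {f₀ g : Ω → ℝ}
    (hf : TendstoInMeasure P f atTop f₀) (hfm : ∀ n, AEStronglyMeasurable (f n) P)
    (hf₀ : AEStronglyMeasurable f₀ P) (hg : AEStronglyMeasurable g P) :
    TendstoInMeasure P (fun n ω => (f n ω - f₀ ω) * g ω) atTop (fun _ => 0) := by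
  have hm : ∀ n, AEStronglyMeasurable (fun ω => (f n ω - f₀ ω) * g ω) P :=
    fun n => ((hfm n).sub hf₀).mul hg
  rw [exists_seq_tendstoInMeasure_atTop_iff hm]
  intro ns hns
  obtain ⟨ms, hms, h⟩ := (hf.comp hns.tendsto_atTop).exists_seq_tendsto_ae
  refine ⟨ms, hms, ?_⟩
  filter_upwards [h] with ω hω
  simpa using (hω.sub_const (f₀ ω)).mul_const (g ω)

theorem tendsto_lintegral_enorm_pow_zero {f : ℕ → Ω → ℝ} {m : ℕ} (hm : m ≠ 0)
    (hfm : ∀ n, AEStronglyMeasurable (f n) P)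
    (hf : TendstoInMeasure P f atTop (fun _ => 0)) (hui : UnifIntegrable f m P) :
    Tendsto (fun n => ∫⁻ ω, ‖f n ω‖ₑ ^ m ∂P) atTop (𝓝 0) := by
  have h := tendsto_Lp_finite_of_tendstoInMeasure (by exact_mod_cast Nat.one_le_iff_ne_zero.2 hm)
    (by simp) hfm (MemLp.zero (ε := ℝ)) hui hf
  have h2 := (ENNReal.continuous_pow m).tendsto 0 |>.comp h
  rw [zero_pow hm] at h2
  refine h2.congr fun n => ?_
  simp only [Function.comp_def, sub_zero]
  rw [eLpNorm_eq_lintegral_rpow_enorm_toReal (by simpa using hm) (by simp)]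
  simp only [ENNReal.toReal_natCast, ENNReal.rpow_natCast, one_div]
  rw [← ENNReal.rpow_natCast, ← ENNReal.rpow_mul, inv_mul_cancel₀ (by exact_mod_cast hm),
    ENNReal.rpow_one]

end condExp

/-! ### From the linearization to convergence and uniform integrability. -/

section linearization

variable {Ω E : Type*} [MeasurableSpace Ω] {P : Measure Ω} [NormedAddCommGroup E]
  {D : ℕ → Ω → ℝ} {S R T T' : ℕ → Ω → E} {κ c ρ : ℝ}

/-- Linearization of an estimator in probability: on the event that the perturbations `D`, `S`,
`R` are moderate, the error of the linear approximation `T'` is controlled by them. -/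
theorem tendstoInMeasure_sub_of_linearization (hκ : 0 ≤ κ) (hc : 0 < c) (hρ : 0 < ρ)
    (hD0 : ∀ n ω, 0 ≤ D n ω)
    (hgood : ∀ᶠ n : ℕ in atTop, ∀ᵐ ω ∂P, D n ω ≤ c → ‖S n ω‖ ≤ ρ * √n → ‖R n ω‖ ≤ ρ * √n →
      ‖T n ω - T' n ω‖ ≤ κ * ‖R n ω‖ + 2 * κ ^ 2 * D n ω * (‖S n ω‖ + ‖R n ω‖))
    (hD : TendstoInMeasure P D atTop (fun _ => 0))
    (hS : ∀ η : ℝ≥0∞, η ≠ 0 → ∃ M : ℝ, 0 < M ∧ ∀ n, P {ω | M ≤ ‖S n ω‖} ≤ η)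
    (hR : TendstoInMeasure P R atTop (fun _ => 0)) :
    TendstoInMeasure P (fun n ω => T n ω - T' n ω) atTop (fun _ => 0) := by
  rw [tendstoInMeasure_iff_norm] at hD hR ⊢
  intro ε hε
  rw [ENNReal.tendsto_nhds_zero]
  intro η hη
  have hη3 : η / 3 ≠ 0 := by simpa using hη.ne'
  obtain ⟨M, hM0, hM⟩ := hS (η / 3) hη3
  -- The thresholds make each of the two error terms at most `ε / 3`, so their sum stays below `ε`.
  -- The cap `1` in `r` gives `‖S‖ + ‖R‖ ≤ M + 1`.
  set r : ℝ := min 1 (ε / (3 * (κ + 1))) with hr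
  have hr0 : 0 < r := lt_min one_pos (by positivity)
  set c' : ℝ := min c (ε / (6 * (κ ^ 2 + 1) * (M + 1))) with hc'
  have hc'0 : 0 < c' := lt_min hc (by positivity)
  have hsq : Tendsto (fun n : ℕ => ρ * √(n : ℝ)) atTop atTop :=
    (Real.tendsto_sqrt_atTop.comp tendsto_natCast_atTop_atTop).const_mul_atTop hρ
  filter_upwards [hgood, (ENNReal.tendsto_nhds_zero.1 (hD c' hc'0)) (η / 3) (pos_iff_ne_zero.2 hη3),
    (ENNReal.tendsto_nhds_zero.1 (hR r hr0)) (η / 3) (pos_iff_ne_zero.2 hη3),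
    hsq.eventually_ge_atTop M, hsq.eventually_ge_atTop r] with n hg h1 h2 h3 h4
  have hsub : ({ω | ε ≤ ‖T n ω - T' n ω - 0‖} : Set Ω) ≤ᵐ[P]
      ({ω | c' ≤ ‖D n ω - 0‖} ∪ {ω | r ≤ ‖R n ω - 0‖} ∪ {ω | M ≤ ‖S n ω‖} : Set Ω) := by
    filter_upwards [hg] with ω hω hbad
    by_contra hcon
    have hcon' : ω ∉ ({ω | c' ≤ ‖D n ω - 0‖} ∪ {ω | r ≤ ‖R n ω - 0‖} ∪ {ω | M ≤ ‖S n ω‖} : Set Ω) :=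
      hcon
    have hbad' : ε ≤ ‖T n ω - T' n ω - 0‖ := hbad
    simp only [sub_zero, Set.mem_union, Set.mem_ofPred_eq, not_or, not_le, Real.norm_eq_abs,
      abs_of_nonneg (hD0 n ω)] at hcon' hbad'
    obtain ⟨⟨g1, g2⟩, g3⟩ := hcon'
    have key := hω (g1.le.trans (min_le_left _ _)) (g3.le.trans h3) (g2.le.trans h4)
    have k1 : κ * ‖R n ω‖ ≤ ε / 3 := by
      calc κ * ‖R n ω‖ ≤ (κ + 1) * (ε / (3 * (κ + 1))) :=
            mul_le_mul (by linarith) (g2.le.trans (min_le_right _ _)) (norm_nonneg _) (by linarith)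
        _ = ε / 3 := by field_simp
    have k2 : 2 * κ ^ 2 * D n ω * (‖S n ω‖ + ‖R n ω‖) ≤ ε / 3 := by
      calc 2 * κ ^ 2 * D n ω * (‖S n ω‖ + ‖R n ω‖)
          ≤ 2 * (κ ^ 2 + 1) * (ε / (6 * (κ ^ 2 + 1) * (M + 1))) * (M + 1) := by
            gcongr
            · exact hD0 n ω
            · linarith
            · exact g1.le.trans (min_le_right _ _)
            · exact g2.le.trans (min_le_left _ _)
        _ = ε / 3 := by field_simp; norm_num
    linarith
  calc P {ω | ε ≤ ‖T n ω - T' n ω - 0‖}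
      ≤ P ({ω | c' ≤ ‖D n ω - 0‖} ∪ {ω | r ≤ ‖R n ω - 0‖} ∪ {ω | M ≤ ‖S n ω‖}) :=
        measure_mono_ae hsub
    _ ≤ P {ω | c' ≤ ‖D n ω - 0‖} + P {ω | r ≤ ‖R n ω - 0‖} + P {ω | M ≤ ‖S n ω‖} :=
        (measure_union_le _ _).trans (add_le_add (measure_union_le _ _) le_rfl)
    _ ≤ η / 3 + η / 3 + η / 3 := add_le_add (add_le_add h1 h2) (hM n)
    _ = η := ENNReal.add_thirds η

/-- The improved tail bound is applied to `‖F‖⁴` at level `a⁴ n²`. The resulting `o(n⁻²)` offsets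
the crude bound of order `n²` on the fourth power of the estimation error. -/
theorem tendsto_sq_mul_measure_norm_gt [MeasurableSpace E] [BorelSpace E] {a : ℝ} (ha : 0 < a)
    {F : ℕ → Ω → E} (hFm : ∀ n, Measurable (F n))
    (hF : AsympUnifIntegrable P fun n ω => ‖F n ω‖ₑ ^ 4) :
    Tendsto (fun n : ℕ => (n : ℝ≥0∞) ^ 2 * P {ω | a * √n < ‖F n ω‖}) atTop (𝓝 0) := by
  lift a to ℝ≥0 using ha.le
  have ha' : (a : ℝ≥0∞) ^ 4 ≠ 0 := by
    have : a ≠ 0 := by exact_mod_cast ha.ne'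
    simpa using this
  have hcn : Tendsto (fun n : ℕ => a ^ 4 * (n : ℝ≥0) ^ 2) atTop atTop := by
    refine Tendsto.const_mul_atTop (by have : 0 < a := by exact_mod_cast ha
                                       positivity) ?_
    exact (tendsto_pow_atTop (by norm_num)).comp tendsto_natCast_atTop_atTop
  have h := hF.tendsto_mul_meas_ge (fun n => by fun_prop) hcn
  have h2 := ENNReal.Tendsto.const_mul (a := ((a : ℝ≥0∞) ^ 4)⁻¹) h
    (Or.inr (by simpa using ha'))
  rw [mul_zero] at h2
  refine tendsto_of_tendsto_of_tendsto_of_le_of_le tendsto_const_nhds h2 (fun _ => zero_le)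
    fun n => ?_
  push_cast
  rw [← mul_assoc, ← mul_assoc, ENNReal.inv_mul_cancel ha' (by simp), one_mul]
  refine mul_le_mul_right (measure_mono fun ω hω => ?_) _
  have hω' : (a : ℝ) * √n < ‖F n ω‖ := hω
  have h4 : (a : ℝ) ^ 4 * (n : ℝ) ^ 2 ≤ ‖F n ω‖ ^ 4 := by
    have := pow_le_pow_left₀ (by positivity) hω'.le 4
    rwa [mul_pow, show (√(n : ℝ)) ^ 4 = (n : ℝ) ^ 2 by
      rw [show 4 = 2 * 2 from rfl, pow_mul, Real.sq_sqrt (by positivity)]] at this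
  have h5 : a ^ 4 * (n : ℝ≥0) ^ 2 ≤ ‖F n ω‖₊ ^ 4 := by
    rw [← NNReal.coe_le_coe]; push_cast; exact h4
  change (a : ℝ≥0∞) ^ 4 * (n : ℝ≥0∞) ^ 2 ≤ ‖F n ω‖ₑ ^ 4
  rw [enorm_eq_nnnorm]
  exact_mod_cast h5

/-- Uniform integrability of the fourth power of an estimation error that is bounded by the
perturbations on the event that these are moderate, and by a multiple of `√n` elsewhere. -/
theorem asympUnifIntegrable_pow_four_of_linearization [MeasurableSpace E] [BorelSpace E]
    {B : ℝ≥0} {κ : ℝ≥0} (hc : 0 < c) (hρ : 0 < ρ)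
    (hgood : ∀ᶠ n : ℕ in atTop, ∀ᵐ ω ∂P, D n ω ≤ c → ‖S n ω‖ ≤ ρ * √n → ‖R n ω‖ ≤ ρ * √n →
      ‖T n ω‖ ≤ κ * (‖S n ω‖ + ‖R n ω‖))
    (hbdd : ∀ᶠ n : ℕ in atTop, ∀ᵐ ω ∂P, ‖T n ω‖ ≤ B * √n)
    (hDm : ∀ n, Measurable (D n)) (hSm : ∀ n, Measurable (S n)) (hRm : ∀ n, Measurable (R n))
    (hD : AsympUnifIntegrable P fun n ω => ‖√n * D n ω‖ₑ ^ 4)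
    (hS : AsympUnifIntegrable P fun n ω => ‖S n ω‖ₑ ^ 4)
    (hR : Tendsto (fun n => ∫⁻ ω, ‖R n ω‖ₑ ^ 4 ∂P) atTop (𝓝 0)) :
    AsympUnifIntegrable P fun n ω => ‖T n ω‖ₑ ^ 4 := by
  have hR' := AsympUnifIntegrable.of_tendsto_lintegral_zero hR
  -- Multiplying `D` by `√n` gives all three events the form `a √n < ‖F n‖`.
  set bad : ℕ → Set Ω := fun n =>
    {ω | c * √n < ‖√n * D n ω‖} ∪ {ω | ρ * √n < ‖S n ω‖} ∪ {ω | ρ * √n < ‖R n ω‖} with hbad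
  have hP : Tendsto (fun n : ℕ => (n : ℝ≥0∞) ^ 2 * P (bad n)) atTop (𝓝 0) := by
    have h := ((tendsto_sq_mul_measure_norm_gt hc (fun n => by fun_prop) hD).add
      (tendsto_sq_mul_measure_norm_gt hρ hSm hS)).add (tendsto_sq_mul_measure_norm_gt hρ hRm hR')
    simp only [add_zero] at h
    refine tendsto_of_tendsto_of_tendsto_of_le_of_le tendsto_const_nhds h (fun _ => zero_le)
      fun n => ?_
    simp only
    rw [← mul_add, ← mul_add]
    exact mul_le_mul_right ((measure_union_le _ _).trans
      (add_le_add (measure_union_le _ _) le_rfl)) _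
  have hbadUI : AsympUnifIntegrable P
      fun n ω => (bad n).indicator (fun _ => (B : ℝ≥0∞) ^ 4 * (n : ℝ≥0∞) ^ 2) ω := by
    refine AsympUnifIntegrable.of_tendsto_lintegral_zero ?_
    have h := ENNReal.Tendsto.const_mul (a := (B : ℝ≥0∞) ^ 4) hP (Or.inr (by simp))
    rw [mul_zero] at h
    refine tendsto_of_tendsto_of_tendsto_of_le_of_le tendsto_const_nhds h (fun _ => zero_le)
      fun n => (lintegral_indicator_const_le _ _).trans (by rw [mul_assoc])
  -- The factor `8` comes from `(x + y)⁴ ≤ 8 (x⁴ + y⁴)`.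
  refine (((hS.add hR' fun n => by fun_prop).const_mul (κ ^ 4 * 8)).add hbadUI
    fun n => by fun_prop).mono ?_
  filter_upwards [hgood, hbdd, eventually_gt_atTop 0] with n hg hb hn
  filter_upwards [hg, hb] with ω hgω hbω
  by_cases hω : ω ∈ bad n
  · rw [Set.indicator_of_mem hω]
    refine le_trans ?_ le_add_self
    have h1 : ‖T n ω‖ ^ 4 ≤ (B : ℝ) ^ 4 * (n : ℝ) ^ 2 := by
      have := pow_le_pow_left₀ (norm_nonneg _) hbω 4
      rwa [mul_pow, show (√(n : ℝ)) ^ 4 = (n : ℝ) ^ 2 by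
        rw [show 4 = 2 * 2 from rfl, pow_mul, Real.sq_sqrt (by positivity)]] at this
    have h2 : ‖T n ω‖₊ ^ 4 ≤ B ^ 4 * (n : ℝ≥0) ^ 2 := by
      rw [← NNReal.coe_le_coe]; push_cast; exact h1
    rw [enorm_eq_nnnorm]
    exact_mod_cast h2
  · refine le_trans ?_ le_self_add
    simp only [hbad, Set.mem_union, Set.mem_ofPred_eq, not_or, not_lt] at hω
    obtain ⟨⟨h1, h2⟩, h3⟩ := hω
    have hsn : 0 < √(n : ℝ) := Real.sqrt_pos.2 (by exact_mod_cast hn)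
    have hD' : D n ω ≤ c := by
      have : √(n : ℝ) * D n ω ≤ √(n : ℝ) * c := by
        rw [mul_comm _ c]; exact (le_abs_self _).trans h1
      exact le_of_mul_le_mul_left this hsn
    have h4 := hgω hD' h2 h3
    have h5 : ‖T n ω‖ ^ 4 ≤ (κ : ℝ) ^ 4 * 8 * (‖S n ω‖ ^ 4 + ‖R n ω‖ ^ 4) := by
      refine (pow_le_pow_left₀ (norm_nonneg _) h4 4).trans ?_
      rw [mul_pow, mul_assoc]
      gcongr
      have := add_pow_le (norm_nonneg (S n ω)) (norm_nonneg (R n ω)) 4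
      norm_num at this
      exact this
    have h6 : ‖T n ω‖₊ ^ 4 ≤ κ ^ 4 * 8 * (‖S n ω‖₊ ^ 4 + ‖R n ω‖₊ ^ 4) := by
      rw [← NNReal.coe_le_coe]; push_cast; exact h5
    simp only [enorm_eq_nnnorm]
    exact_mod_cast h6

end linearization

/-! ### Norm bounds by coordinates and Chebyshev estimates. -/

section normBounds

variable {Ω ι : Type*} [MeasurableSpace Ω] {P : Measure Ω} {d : ℕ}

theorem tendstoInMeasure_clm_comp {E F : Type*} [NormedAddCommGroup E] [NormedSpace ℝ E]
    [NormedAddCommGroup F] [NormedSpace ℝ F] (L : E →L[ℝ] F) {f : ℕ → Ω → E}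
    (hf : TendstoInMeasure P f atTop (fun _ => 0)) :
    TendstoInMeasure P (fun n ω => L (f n ω)) atTop (fun _ => 0) := by
  rw [tendstoInMeasure_iff_norm] at hf ⊢
  intro ε hε
  refine tendsto_of_tendsto_of_tendsto_of_le_of_le tendsto_const_nhds
    (hf (ε / (‖L‖ + 1)) (by positivity)) (fun _ => zero_le) fun n => measure_mono fun ω hω => ?_
  simp only [sub_zero, Set.mem_ofPred_eq] at hω ⊢
  rw [div_le_iff₀ (by positivity)]
  refine hω.trans ((L.le_opNorm _).trans ?_)
  rw [mul_comm]
  gcongr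
  linarith

/-- The power-mean inequality; it reduces vector estimates to scalar coordinates. -/
theorem enorm_pow_succ_le_sum {E : Type*} [NormedAddCommGroup E] {s : Finset ι} {v : E} {f : ι → ℝ}
    (hv : ‖v‖ ≤ ∑ i ∈ s, |f i|) (k : ℕ) :
    ‖v‖ₑ ^ (k + 1) ≤ ((s.card ^ k : ℝ≥0) : ℝ≥0∞) * ∑ i ∈ s, ‖f i‖ₑ ^ (k + 1) := by
  have h1 : ‖v‖₊ ≤ ∑ i ∈ s, ‖f i‖₊ := by
    rw [← NNReal.coe_le_coe]; push_cast; simpa using hv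
  have h2 : ‖v‖₊ ^ (k + 1) ≤ (s.card : ℝ≥0) ^ k * ∑ i ∈ s, ‖f i‖₊ ^ (k + 1) :=
    (pow_le_pow_left₀ (zero_le) h1 _).trans
      (pow_sum_le_card_mul_sum_pow (fun i _ => zero_le) k)
  simp only [enorm_eq_nnnorm]
  exact_mod_cast h2

theorem AsympUnifIntegrable.of_norm_le_sum {E : Type*} [NormedAddCommGroup E] {s : Finset ι}
    {v : ℕ → Ω → E} {f : ι → ℕ → Ω → ℝ} (hv : ∀ n ω, ‖v n ω‖ ≤ ∑ i ∈ s, |f i n ω|)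
    (hfm : ∀ i n, Measurable (f i n)) (k : ℕ)
    (hf : ∀ i ∈ s, AsympUnifIntegrable P fun n ω => ‖f i n ω‖ₑ ^ (k + 1)) :
    AsympUnifIntegrable P fun n ω => ‖v n ω‖ₑ ^ (k + 1) :=
  ((AsympUnifIntegrable.sum s hf fun i n => by fun_prop).const_mul (s.card ^ k)).mono
    (Eventually.of_forall fun n => ae_of_all _ fun ω => enorm_pow_succ_le_sum (hv n ω) k)

theorem lintegral_enorm_pow_succ_le_sum {E : Type*} [NormedAddCommGroup E] {s : Finset ι}
    {v : Ω → E} {f : ι → Ω → ℝ} (hv : ∀ ω, ‖v ω‖ ≤ ∑ i ∈ s, |f i ω|)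
    (hfm : ∀ i, Measurable (f i)) (k : ℕ) :
    ∫⁻ ω, ‖v ω‖ₑ ^ (k + 1) ∂P
      ≤ ((s.card ^ k : ℝ≥0) : ℝ≥0∞) * ∑ i ∈ s, ∫⁻ ω, ‖f i ω‖ₑ ^ (k + 1) ∂P := by
  rw [← lintegral_finsetSum _ fun i _ => by fun_prop, ← lintegral_const_mul _ (by fun_prop)]
  exact lintegral_mono fun ω => enorm_pow_succ_le_sum (hv ω) k

theorem measure_norm_ge_le_of_lintegral_sq_le {E : Type*} [NormedAddCommGroup E]
    [MeasurableSpace E] [BorelSpace E] {F : ℕ → Ω → E} (hF : ∀ n, Measurable (F n)) {C : ℝ≥0∞}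
    (hC : C ≠ ∞) (h : ∀ n, ∫⁻ ω, ‖F n ω‖ₑ ^ 2 ∂P ≤ C) (η : ℝ≥0∞) (hη : η ≠ 0) :
    ∃ M : ℝ, 0 < M ∧ ∀ n, P {ω | M ≤ ‖F n ω‖} ≤ η := by
  lift C to ℝ≥0 using hC
  have hlim : Tendsto (fun M : ℕ => (C : ℝ≥0∞) / ((M : ℝ≥0∞) ^ 2)) atTop (𝓝 0) := by
    have h1 : Tendsto (fun M : ℕ => (M : ℝ≥0∞) ^ 2) atTop (𝓝 ∞) := by
      have := ((ENNReal.continuous_pow 2).tendsto ∞).comp ENNReal.tendsto_nat_nhds_top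
      simpa [Function.comp_def] using this
    have := ENNReal.Tendsto.const_div (a := (C : ℝ≥0∞)) h1 (Or.inr (by simp))
    simpa using this
  obtain ⟨M, hM, hM0⟩ := ((ENNReal.tendsto_nhds_zero.1 hlim η (pos_iff_ne_zero.2 hη)).and
    (eventually_gt_atTop 0)).exists
  refine ⟨M, by exact_mod_cast hM0, fun n => ?_⟩
  refine le_trans ?_ ((meas_ge_le_lintegral_div (μ := P) (f := fun ω => ‖F n ω‖ₑ ^ 2)
    (ε := (M : ℝ≥0∞) ^ 2) (by fun_prop) (by simpa using hM0.ne') (by simp)).trans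
    ((ENNReal.div_le_div_right (h n) _).trans hM))
  refine measure_mono fun ω hω => ?_
  have h1 : (M : ℝ) ≤ ‖F n ω‖ := hω
  have h2 : (M : ℝ≥0) ≤ ‖F n ω‖₊ := by rw [← NNReal.coe_le_coe]; simpa using h1
  change (M : ℝ≥0∞) ^ 2 ≤ ‖F n ω‖ₑ ^ 2
  gcongr
  rw [enorm_eq_nnnorm]
  exact_mod_cast h2

theorem tendstoInMeasure_zero_of_tendsto_lintegral_sq {E : Type*} [NormedAddCommGroup E]
    [MeasurableSpace E] [BorelSpace E] {F : ℕ → Ω → E} (hF : ∀ n, Measurable (F n))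
    (h : Tendsto (fun n => ∫⁻ ω, ‖F n ω‖ₑ ^ 2 ∂P) atTop (𝓝 0)) :
    TendstoInMeasure P F atTop (fun _ => 0) := by
  rw [tendstoInMeasure_iff_norm]
  intro ε hε
  lift ε to ℝ≥0 using hε.le
  have hε' : (ε : ℝ≥0∞) ^ 2 ≠ 0 := by
    have : ε ≠ 0 := by rintro rfl; simp at hε
    simpa using this
  have h2 := ENNReal.Tendsto.div_const (b := (ε : ℝ≥0∞) ^ 2) h (Or.inr hε')
  rw [ENNReal.zero_div] at h2
  refine tendsto_of_tendsto_of_tendsto_of_le_of_le tendsto_const_nhds h2 (fun _ => zero_le)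
    fun n => le_trans (measure_mono fun ω hω => ?_)
      (meas_ge_le_lintegral_div (f := fun ω => ‖F n ω‖ₑ ^ 2) (by fun_prop) hε' (by simp))
  have h1 : (ε : ℝ) ≤ ‖F n ω - 0‖ := hω
  rw [sub_zero] at h1
  have h3 : ε ≤ ‖F n ω‖₊ := by rw [← NNReal.coe_le_coe]; simpa using h1
  change (ε : ℝ≥0∞) ^ 2 ≤ ‖F n ω‖ₑ ^ 2
  gcongr
  rw [enorm_eq_nnnorm]
  exact_mod_cast h3

end normBounds

/-! ### Algebra of the moment equation. -/

section model

variable {Ω : Type*} {d : ℕ}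

/-- The normalized weighted sum `n^{-1/2} ∑_{i < n} wᵢ Xᵢ`. -/
noncomputable def normalizedSum (X : ℕ → Ω → EuclideanSpace ℝ (Fin d)) (w : ℕ → Ω → ℝ) (n : ℕ) (ω : Ω) :
    EuclideanSpace ℝ (Fin d) :=
  (√(n : ℝ))⁻¹ • ∑ i ∈ Finset.range n, w i ω • X i ω

/-- The empirical counterpart of the Jacobian matrix. -/
noncomputable def empiricalJacobian (X : ℕ → Ω → EuclideanSpace ℝ (Fin d)) (Z A : ℕ → Ω → ℝ) (n : ℕ) (ω : Ω) :
    Matrix (Fin d) (Fin d) ℝ :=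
  Matrix.of fun i j => (n : ℝ)⁻¹ * ∑ k ∈ Finset.range n, A k ω * Z k ω * (X k ω i * X k ω j)

/-- The entrywise `ℓ¹` distance between the empirical Jacobian and a matrix `J`. -/
noncomputable def jacobianDeviation (X : ℕ → Ω → EuclideanSpace ℝ (Fin d)) (Z A : ℕ → Ω → ℝ)
    (J : Matrix (Fin d) (Fin d) ℝ) (n : ℕ) (ω : Ω) : ℝ :=
  ∑ i, ∑ j, |empiricalJacobian X Z A n ω i j - J i j|

theorem normalizedSum_apply (X : ℕ → Ω → EuclideanSpace ℝ (Fin d)) (w : ℕ → Ω → ℝ) (n : ℕ) (ω : Ω)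
    (j : Fin d) : normalizedSum X w n ω j
      = (√(n : ℝ))⁻¹ * ∑ i ∈ Finset.range n, w i ω * X i ω j := by
  simp [normalizedSum]

theorem toEuclideanLin_empiricalJacobian (X : ℕ → Ω → EuclideanSpace ℝ (Fin d)) (Z A : ℕ → Ω → ℝ)
    (n : ℕ) (ω : Ω) (v : EuclideanSpace ℝ (Fin d)) :
    Matrix.toEuclideanLin (empiricalJacobian X Z A n ω) v
      = (n : ℝ)⁻¹ • ∑ k ∈ Finset.range n, (A k ω * Z k ω * inner ℝ v (X k ω)) • X k ω := by
  ext i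
  simp only [Matrix.toLpLin_apply, Matrix.mulVec, dotProduct, empiricalJacobian, Matrix.of_apply,
    PiLp.smul_apply, WithLp.ofLp_sum, Finset.sum_apply, smul_eq_mul, PiLp.inner_apply,
    RCLike.inner_apply, conj_trivial, WithLp.ofLp_smul, Pi.smul_apply]
  simp_rw [mul_assoc, ← Finset.mul_sum, Finset.sum_mul]
  rw [Finset.sum_comm]
  congr 1
  refine Finset.sum_congr rfl fun k _ => ?_
  rw [Finset.mul_sum, Finset.mul_sum]
  refine Finset.sum_congr rfl fun j _ => ?_
  ring

theorem sampleMoment_eq {X : ℕ → Ω → EuclideanSpace ℝ (Fin d)} {Z A Y : ℕ → Ω → ℝ}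
    (θ₀ : EuclideanSpace ℝ (Fin d)) (f₀ g : EuclideanSpace ℝ (Fin d) → ℝ) {n : ℕ} (hn : 0 < n)
    (ω : Ω) (θ : EuclideanSpace ℝ (Fin d)) :
    sampleMoment X Z A Y n ω g θ = (√(n : ℝ))⁻¹ •
      (normalizedSum X (fun i ω => structuralResidual θ₀ f₀ (X i) (A i) (Y i) ω * Z i ω) n ω
        - normalizedSum X (fun i ω => (g (X i ω) - f₀ (X i ω)) * Z i ω) n ω
        - Matrix.toEuclideanLin (empiricalJacobian X Z A n ω) (√(n : ℝ) • (θ - θ₀))) := by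
  have hs : √(n : ℝ) ≠ 0 := (Real.sqrt_pos.2 (by exact_mod_cast hn)).ne'
  have hss : (n : ℝ)⁻¹ = (√(n : ℝ))⁻¹ * (√(n : ℝ))⁻¹ := by
    rw [← mul_inv, Real.mul_self_sqrt (by positivity)]
  rw [map_smul, toEuclideanLin_empiricalJacobian, smul_sub, smul_sub, smul_smul, inv_mul_cancel₀ hs,
    one_smul, normalizedSum, normalizedSum, smul_smul, smul_smul, ← hss, sampleMoment,
    ← smul_sub, ← smul_sub, ← Finset.sum_sub_distrib, ← Finset.sum_sub_distrib]
  congr 1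
  refine Finset.sum_congr rfl fun i _ => ?_
  rw [← sub_smul, ← sub_smul]
  congr 1
  simp only [structuralResidual, inner_sub_left]
  ring

/-- On the event that the perturbations are moderate, the moment equation has a solution in `Θ`
and any solution is controlled by the perturbations. -/
theorem moment_solution_bounds {X : ℕ → Ω → EuclideanSpace ℝ (Fin d)} {Z A Y : ℕ → Ω → ℝ}
    {θ₀ θ : EuclideanSpace ℝ (Fin d)} {f₀ g : EuclideanSpace ℝ (Fin d) → ℝ} {n : ℕ} (hn : 0 < n)
    {ω : Ω} {J : Matrix (Fin d) (Fin d) ℝ} (hJ : IsUnit J) {κ r : ℝ} (hκ : 0 < κ)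
    (hK : ∀ v, ‖Matrix.toEuclideanLin J⁻¹ v‖ ≤ κ * ‖v‖) {Θ : Set (EuclideanSpace ℝ (Fin d))}
    (hr : 0 < r) (hΘ : Metric.ball θ₀ r ⊆ Θ)
    {S R : EuclideanSpace ℝ (Fin d)}
    (hSdef : S = normalizedSum X
      (fun i ω => structuralResidual θ₀ f₀ (X i) (A i) (Y i) ω * Z i ω) n ω)
    (hRdef : R = normalizedSum X (fun i ω => (g (X i ω) - f₀ (X i ω)) * Z i ω) n ω)
    (hθ : (∃ θ ∈ Θ, sampleMoment X Z A Y n ω g θ = 0) → sampleMoment X Z A Y n ω g θ = 0)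
    (hD : jacobianDeviation X Z A J n ω ≤ 1 / (2 * κ))
    (hS : ‖S‖ ≤ r / (8 * κ) * √n) (hR : ‖R‖ ≤ r / (8 * κ) * √n) :
    ‖√(n : ℝ) • (θ - θ₀) - Matrix.toEuclideanLin J⁻¹ S‖
        ≤ κ * ‖R‖ + 2 * κ ^ 2 * jacobianDeviation X Z A J n ω * (‖S‖ + ‖R‖) ∧
      ‖√(n : ℝ) • (θ - θ₀)‖ ≤ 2 * κ * (‖S‖ + ‖R‖) := by
  have hs : 0 < √(n : ℝ) := Real.sqrt_pos.2 (by exact_mod_cast hn)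
  set δ := jacobianDeviation X Z A J n ω with hδdef
  have hδ0 : 0 ≤ δ := Finset.sum_nonneg fun i _ => Finset.sum_nonneg fun j _ => abs_nonneg _
  have hKJ : ∀ v, Matrix.toEuclideanLin J⁻¹ (Matrix.toEuclideanLin J v) = v := fun v => by
    rw [← LinearMap.comp_apply, ← Matrix.toLpLin_mul 2 2 2,
      Matrix.nonsing_inv_mul _ ((Matrix.isUnit_iff_isUnit_det _).1 hJ), Matrix.toLpLin_one]
    rfl
  have hδ : ∀ v, ‖Matrix.toEuclideanLin (empiricalJacobian X Z A n ω) v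
      - Matrix.toEuclideanLin J v‖ ≤ δ * ‖v‖ := fun v => by
    rw [← LinearMap.sub_apply, ← map_sub]
    exact norm_toEuclideanLin_le_sum _ v
  have hκδ : κ * δ ≤ 1 / 2 := by
    calc κ * δ ≤ κ * (1 / (2 * κ)) := by gcongr
      _ = 1 / 2 := by field_simp
  have hzero : ∀ θ, sampleMoment X Z A Y n ω g θ = 0 ↔
      Matrix.toEuclideanLin (empiricalJacobian X Z A n ω) (√(n : ℝ) • (θ - θ₀)) = S - R := fun θ => by
    rw [sampleMoment_eq θ₀ f₀ g hn, ← hSdef, ← hRdef, smul_eq_zero, inv_eq_zero, or_iff_right hs.ne',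
      sub_eq_zero, eq_comm]
  have hbd : ∀ v, Matrix.toEuclideanLin (empiricalJacobian X Z A n ω) v = S - R →
      ‖v‖ ≤ 2 * κ * (‖S‖ + ‖R‖) := fun v hv => by
    have := norm_le_of_perturbed_inverse hKJ hK hκ.le hδ hκδ v
    rw [hv] at this
    refine this.trans ?_
    gcongr
    exact norm_sub_le _ _
  -- This root serves only to show that the equation is solvable in `Θ`; the estimator is then a
  -- root itself and obeys the same bounds.
  obtain ⟨v, hv⟩ := surjective_of_perturbed_inverse hKJ hK hκ.le hδ hκδ (S - R)
  have hsol : sampleMoment X Z A Y n ω g θ = 0 := by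
    refine hθ ⟨θ₀ + (√(n : ℝ))⁻¹ • v, hΘ ?_, ?_⟩
    · rw [mem_ball_iff_norm, add_sub_cancel_left, norm_smul, norm_inv, Real.norm_of_nonneg hs.le]
      -- With both perturbations at most `r / (8κ) √n`, the bound `2κ (‖S‖ + ‖R‖)` puts the root
      -- within `r / 2` of `θ₀`.
      calc (√(n : ℝ))⁻¹ * ‖v‖
          ≤ (√(n : ℝ))⁻¹ * (2 * κ * (r / (8 * κ) * √n + r / (8 * κ) * √n)) := by
            gcongr
            refine (hbd v hv).trans ?_
            gcongr
        _ = r / 2 := by field_simp; norm_num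
        _ < r := by linarith
    · rw [hzero, add_sub_cancel_left, smul_smul, mul_inv_cancel₀ hs.ne', one_smul, hv]
  rw [hzero] at hsol
  exact ⟨norm_sub_le_of_perturbed_inverse hKJ hK hκ.le hδ0 hδ hκδ hsol, hbd _ hsol⟩

end model

/-! ### Stochastic behaviour of the empirical Jacobian. -/

section modelProbability

variable {Ω : Type*} [MeasurableSpace Ω] {P : Measure Ω} [IsProbabilityMeasure P] {d : ℕ}
  {X : ℕ → Ω → EuclideanSpace ℝ (Fin d)} {w : ℕ → Ω → ℝ}

theorem measurable_normalizedSum (hX : ∀ i, Measurable (X i)) (hw : ∀ i, Measurable (w i)) (n : ℕ) :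
    Measurable (normalizedSum X w n) := by
  unfold normalizedSum
  fun_prop

theorem measurable_jacobianDeviation {Z A : ℕ → Ω → ℝ} (hX : ∀ i, Measurable (X i))
    (hZ : ∀ i, Measurable (Z i)) (hA : ∀ i, Measurable (A i)) (J : Matrix (Fin d) (Fin d) ℝ)
    (n : ℕ) : Measurable (jacobianDeviation X Z A J n) := by
  unfold jacobianDeviation empiricalJacobian
  simp only [Matrix.of_apply]
  fun_prop

theorem tendstoInMeasure_jacobianDeviation {Z A : ℕ → Ω → ℝ} (hX : ∀ i, Measurable (X i))
    (hZ : ∀ i, Measurable (Z i)) (hA : ∀ i, Measurable (A i))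
    (hind : ∀ i j, iIndepFun (fun k ω => A k ω * Z k ω * (X k ω i * X k ω j)) P)
    (hid : ∀ i j k, IdentDistrib (fun ω => A k ω * Z k ω * (X k ω i * X k ω j))
      (fun ω => A 0 ω * Z 0 ω * (X 0 ω i * X 0 ω j)) P P)
    (hint : ∀ i j, Integrable (fun ω => A 0 ω * Z 0 ω * (X 0 ω i * X 0 ω j)) P) :
    TendstoInMeasure P (jacobianDeviation X Z A (jacobianMatrix P (X 0) (Z 0) (A 0))) atTop
      (fun _ => 0) := by
  refine tendstoInMeasure_of_tendsto_ae
    (fun n => (measurable_jacobianDeviation hX hZ hA _ n).aestronglyMeasurable) ?_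
  have h : ∀ᵐ ω ∂P, ∀ i j, Tendsto (fun n => empiricalJacobian X Z A n ω i j) atTop
      (𝓝 (jacobianMatrix P (X 0) (Z 0) (A 0) i j)) := by
    rw [ae_all_iff]; intro i
    rw [ae_all_iff]; intro j
    filter_upwards [strong_law_ae_real (fun k ω => A k ω * Z k ω * (X k ω i * X k ω j)) (hint i j)
      (fun k l hkl => (hind i j).indepFun hkl) (hid i j)] with ω hω
    simpa [empiricalJacobian, jacobianMatrix, div_eq_inv_mul] using hω
  filter_upwards [h] with ω hω
  have : Tendsto (fun n => jacobianDeviation X Z A (jacobianMatrix P (X 0) (Z 0) (A 0)) n ω) atTop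
      (𝓝 (∑ i : Fin d, ∑ j : Fin d, |(0 : ℝ)|)) := by
    refine tendsto_finsetSum _ fun i _ => tendsto_finsetSum _ fun j _ => Tendsto.abs ?_
    simpa using (hω i j).sub_const (jacobianMatrix P (X 0) (Z 0) (A 0) i j)
  simpa using this

theorem asympUnifIntegrable_jacobianDeviation {Z A : ℕ → Ω → ℝ} (hX : ∀ i, Measurable (X i))
    (hZ : ∀ i, Measurable (Z i)) (hA : ∀ i, Measurable (A i))
    (hind : ∀ i j, iIndepFun (fun k ω => A k ω * Z k ω * (X k ω i * X k ω j)) P)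
    (hid : ∀ i j k, IdentDistrib (fun ω => A k ω * Z k ω * (X k ω i * X k ω j))
      (fun ω => A 0 ω * Z 0 ω * (X 0 ω i * X 0 ω j)) P P)
    (h4 : ∀ i j, MemLp (fun ω => A 0 ω * Z 0 ω * (X 0 ω i * X 0 ω j)) 4 P) :
    AsympUnifIntegrable P fun n ω =>
      ‖√(n : ℝ) * jacobianDeviation X Z A (jacobianMatrix P (X 0) (Z 0) (A 0)) n ω‖ₑ ^ 4 := by
  set J := jacobianMatrix P (X 0) (Z 0) (A 0) with hJ
  set f : Fin d × Fin d → ℕ → Ω → ℝ := fun q n ω => (√(n : ℝ))⁻¹ *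
    ∑ k ∈ Finset.range n, (A k ω * Z k ω * (X k ω q.1 * X k ω q.2) - J q.1 q.2) with hf
  refine AsympUnifIntegrable.of_norm_le_sum (s := Finset.univ) (f := f) ?_ ?_ 3 ?_
  · intro n ω
    -- For `n = 0` both sides vanish, because `√0 = 0` and its inverse is `0`.
    rcases Nat.eq_zero_or_pos n with rfl | hn
    · simp [hf]
    have hn' : (0 : ℝ) < n := by exact_mod_cast hn
    have hs : 0 < √(n : ℝ) := Real.sqrt_pos.2 hn'
    rw [norm_mul, Real.norm_of_nonneg hs.le, Real.norm_of_nonneg, jacobianDeviation,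
      Fintype.sum_prod_type, Finset.mul_sum]
    · refine Finset.sum_le_sum fun i _ => ?_
      rw [Finset.mul_sum]
      refine Finset.sum_le_sum fun j _ => le_of_eq ?_
      rw [← abs_of_pos hs, ← abs_mul]
      congr 1
      simp only [hf, empiricalJacobian, Matrix.of_apply, Finset.sum_sub_distrib, Finset.sum_const,
        Finset.card_range, nsmul_eq_mul]
      have hss : √(n : ℝ) * √(n : ℝ) = n := Real.mul_self_sqrt hn'.le
      generalize √(n : ℝ) = s at hs hss ⊢
      rw [← hss]
      field_simp
    · exact Finset.sum_nonneg fun i _ => Finset.sum_nonneg fun j _ => abs_nonneg _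
  · intro q n
    simp only [hf]
    fun_prop
  · rintro ⟨i, j⟩ -
    have hsub : Measurable fun x : ℝ => x - J i j := by fun_prop
    have h := asympUnifIntegrable_normalized_sum_pow_four (P := P)
      (X := fun k ω => A k ω * Z k ω * (X k ω i * X k ω j) - J i j) (fun k => by fun_prop)
      ((hind i j).comp (fun _ x => x - J i j) fun _ => hsub) (fun k => (hid i j k).comp hsub)
      ((h4 i j).sub (memLp_const _)) (by
        rw [integral_sub ((h4 i j).integrable (by norm_num)) (integrable_const _)]
        simp [hJ, jacobianMatrix])
    convert! h using 4 with n ω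
    rw [← ofReal_norm, ← ENNReal.ofReal_pow (norm_nonneg _), Real.norm_eq_abs,
      Even.pow_abs (by decide)]

end modelProbability

/-! ### The quadratic form of the limit matrix. -/

section limitMatrix

variable {d : ℕ} {V J S : Matrix (Fin d) (Fin d) ℝ}

theorem inner_limitMatrix (hJ : J.IsHermitian) (u v : EuclideanSpace ℝ (Fin d)) :
    inner ℝ u (Matrix.toEuclideanLin (limitMatrix V J S) v)
      = inner ℝ (Matrix.toEuclideanLin J⁻¹ (Matrix.toEuclideanLin (CFC.sqrt V) u))
        (Matrix.toEuclideanLin S (Matrix.toEuclideanLin J⁻¹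
          (Matrix.toEuclideanLin (CFC.sqrt V) v))) := by
  have hQ : (Matrix.toEuclideanLin (CFC.sqrt V)).IsSymmetric :=
    Matrix.isSymmetric_toEuclideanLin_iff.2
      (Matrix.nonneg_iff_posSemidef.1 (CFC.sqrt_nonneg V)).isHermitian
  have hJi : (Matrix.toEuclideanLin J⁻¹).IsSymmetric :=
    Matrix.isSymmetric_toEuclideanLin_iff.2 hJ.inv
  rw [hJi, hQ, limitMatrix]
  simp only [Matrix.toLpLin_mul 2 2 2, LinearMap.comp_apply]

theorem isPositive_limitMatrix (hJ : J.IsHermitian) (hS : (Matrix.toEuclideanLin S).IsPositive) :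
    (Matrix.toEuclideanLin (limitMatrix V J S)).IsPositive := by
  refine ⟨fun u v => ?_, fun u => ?_⟩
  · rw [real_inner_comm, inner_limitMatrix hJ, inner_limitMatrix hJ, real_inner_comm,
      hS.isSymmetric]
  · rw [real_inner_comm, inner_limitMatrix hJ, real_inner_comm]
    exact hS.2 _

theorem inner_map_eq_sum_of_eigenbasis {E : Type*} [NormedAddCommGroup E] [InnerProductSpace ℝ E]
    {ι : Type*} [Fintype ι] {T : E →ₗ[ℝ] E} (hT : T.IsSymmetric) (b : OrthonormalBasis ι ℝ E)
    {lam : ι → ℝ} (hb : ∀ j, T (b j) = lam j • b j) (u : E) :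
    inner ℝ u (T u) = ∑ j, lam j * (b.repr u j) ^ 2 := by
  rw [← b.sum_inner_mul_inner]
  refine Finset.sum_congr rfl fun j _ => ?_
  rw [← hT (b j) u, hb, inner_smul_left, b.repr_apply_apply, real_inner_comm]
  simp
  ring

end limitMatrix

/-! ### The score term. -/

section score

variable {Ω : Type*} [MeasurableSpace Ω] {P : Measure Ω} {d : ℕ}

theorem memLp_smul_of_memLp_mul_norm {X : Ω → EuclideanSpace ℝ (Fin d)} {w : Ω → ℝ} {p : ℝ≥0∞}
    (hX : Measurable X) (hw : Measurable w) (h : MemLp (fun ω => w ω * ‖X ω‖) p P) :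
    MemLp (fun ω => w ω • X ω) p P := by
  refine h.mono (by fun_prop) (ae_of_all _ fun ω => ?_)
  simp [norm_smul]

theorem memLp_mul_coord_of_memLp_mul_norm {X : Ω → EuclideanSpace ℝ (Fin d)} {w : Ω → ℝ} {p : ℝ≥0∞}
    (hX : Measurable X) (hw : Measurable w) (h : MemLp (fun ω => w ω * ‖X ω‖) p P) (j : Fin d) :
    MemLp (fun ω => w ω * X ω j) p P := by
  refine h.mono (by fun_prop) (ae_of_all _ fun ω => ?_)
  rw [norm_mul, norm_mul, norm_norm]
  gcongr
  exact PiLp.norm_apply_le (X ω) j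

theorem iIndepFun_mul_coord {X : ℕ → Ω → EuclideanSpace ℝ (Fin d)} {w : ℕ → Ω → ℝ}
    (hind : iIndepFun (fun i ω => w i ω • X i ω) P) (j : Fin d) :
    iIndepFun (fun i ω => w i ω * X i ω j) P := by
  have h := hind.comp (fun _ (x : EuclideanSpace ℝ (Fin d)) => x j) fun _ => by fun_prop
  simpa [Function.comp_def] using h

theorem identDistrib_mul_coord {X : ℕ → Ω → EuclideanSpace ℝ (Fin d)} {w : ℕ → Ω → ℝ}
    (hid : ∀ i, IdentDistrib (fun ω => w i ω • X i ω) (fun ω => w 0 ω • X 0 ω) P P) (j : Fin d)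
    (i : ℕ) : IdentDistrib (fun ω => w i ω * X i ω j) (fun ω => w 0 ω * X 0 ω j) P P := by
  have h := (hid i).comp (u := fun x : EuclideanSpace ℝ (Fin d) => x j) (by fun_prop)
  simpa [Function.comp_def] using h

variable [IsProbabilityMeasure P] {X : ℕ → Ω → EuclideanSpace ℝ (Fin d)} {w : ℕ → Ω → ℝ}

theorem lintegral_enorm_sq_normalizedSum_le (hX : ∀ i, Measurable (X i))
    (hw : ∀ i, Measurable (w i)) (hind : iIndepFun (fun i ω => w i ω • X i ω) P)
    (hid : ∀ i, IdentDistrib (fun ω => w i ω • X i ω) (fun ω => w 0 ω • X 0 ω) P P)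
    (h0 : ∀ j, ∫ ω, w 0 ω * X 0 ω j ∂P = 0) (n : ℕ) :
    ∫⁻ ω, ‖normalizedSum X w n ω‖ₑ ^ 2 ∂P
      ≤ ((d ^ 1 : ℝ≥0) : ℝ≥0∞) * ∑ j : Fin d, ∫⁻ ω, ‖w 0 ω * X 0 ω j‖ₑ ^ 2 ∂P := by
  refine (lintegral_enorm_pow_succ_le_sum (s := Finset.univ)
    (f := fun j ω => normalizedSum X w n ω j)
    (fun ω => EuclideanSpace.norm_le_sum_abs _) (fun j => ?_) 1).trans ?_
  · have := measurable_normalizedSum hX hw n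
    fun_prop
  rw [Finset.card_univ, Fintype.card_fin]
  refine mul_le_mul_right (Finset.sum_le_sum fun j _ => ?_) _
  simp_rw [normalizedSum_apply]
  exact lintegral_enorm_normalized_sum_sq_le (X := fun i ω => w i ω * X i ω j) (by fun_prop)
    (iIndepFun_mul_coord hind j) (identDistrib_mul_coord hid j) (fun _ => h0 j) n

theorem asympUnifIntegrable_normalizedSum (hX : ∀ i, Measurable (X i))
    (hw : ∀ i, Measurable (w i)) (hind : iIndepFun (fun i ω => w i ω • X i ω) P)
    (hid : ∀ i, IdentDistrib (fun ω => w i ω • X i ω) (fun ω => w 0 ω • X 0 ω) P P)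
    (h0 : ∀ j, ∫ ω, w 0 ω * X 0 ω j ∂P = 0) (h4 : ∀ j, MemLp (fun ω => w 0 ω * X 0 ω j) 4 P) :
    AsympUnifIntegrable P fun n ω => ‖normalizedSum X w n ω‖ₑ ^ 4 := by
  refine AsympUnifIntegrable.of_norm_le_sum (s := Finset.univ)
    (f := fun j n ω => normalizedSum X w n ω j)
    (fun n ω => EuclideanSpace.norm_le_sum_abs _) (fun j n => ?_) 3 fun j _ => ?_
  · have := measurable_normalizedSum hX hw n
    fun_prop
  have h := asympUnifIntegrable_normalized_sum_pow_four (X := fun i ω => w i ω * X i ω j)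
    (by fun_prop) (iIndepFun_mul_coord hind j) (identDistrib_mul_coord hid j) (h4 j) (h0 j)
  convert! h using 4 with n ω
  rw [← ofReal_norm, ← ENNReal.ofReal_pow (norm_nonneg _), Real.norm_eq_abs,
    Even.pow_abs (by decide), normalizedSum_apply]

end score

/-! ### The nuisance term. -/

section nuisanceTerm

variable {Ω 𝒲 : Type*} [MeasurableSpace Ω] [MeasurableSpace 𝒲] {P : Measure Ω}
  [IsProbabilityMeasure P] {d : ℕ} {X : ℕ → Ω → EuclideanSpace ℝ (Fin d)} {Z A Y : ℕ → Ω → ℝ}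
  {f₀ : EuclideanSpace ℝ (Fin d) → ℝ} {W : ℕ → Ω → 𝒲}
  {fhat : ℕ → 𝒲 → EuclideanSpace ℝ (Fin d) → ℝ}

/-- The contribution of the estimation error of the nuisance function to the moment equation. -/
noncomputable def nuisanceTerm (X : ℕ → Ω → EuclideanSpace ℝ (Fin d)) (Z : ℕ → Ω → ℝ)
    (f₀ : EuclideanSpace ℝ (Fin d) → ℝ) (W : ℕ → Ω → 𝒲)
    (fhat : ℕ → 𝒲 → EuclideanSpace ℝ (Fin d) → ℝ) (n : ℕ) (ω : Ω) : EuclideanSpace ℝ (Fin d) :=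
  normalizedSum X (fun i ω => (fhat n (W n ω) (X i ω) - f₀ (X i ω)) * Z i ω) n ω

theorem measurable_nuisance_weight (hXm : ∀ i, Measurable (X i)) (hZm : ∀ i, Measurable (Z i))
    (hf₀ : Measurable f₀) (hWm : ∀ n, Measurable (W n))
    (hfm : ∀ n, Measurable (Function.uncurry (fhat n))) (n i : ℕ) :
    Measurable fun ω => (fhat n (W n ω) (X i ω) - f₀ (X i ω)) * Z i ω :=
  (((hfm n).comp ((hWm n).prodMk (hXm i))).sub (hf₀.comp (hXm i))).mul (hZm i)

/-- The sum costs no more, up to a constant, than one summand, whose moment of order `k + 1` tends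
to `0` by Vitali. The values `k = 1` and `k = 3` serve the limit law and the convergence of moments.
-/
theorem tendsto_lintegral_nuisanceTerm (hXm : ∀ i, Measurable (X i)) (hZm : ∀ i, Measurable (Z i))
    (hAm : ∀ i, Measurable (A i)) (hYm : ∀ i, Measurable (Y i))
    (hindep : iIndepFun (fun i ω => (X i ω, Z i ω, A i ω, Y i ω)) P)
    (hident : ∀ i, IdentDistrib (fun ω => (X i ω, Z i ω, A i ω, Y i ω))
      (fun ω => (X 0 ω, Z 0 ω, A 0 ω, Y 0 ω)) P P)
    (hf₀ : Measurable f₀) (hZint : Integrable (Z 0) P)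
    (hZX : P[Z 0 | MeasurableSpace.comap (X 0) inferInstance] =ᵐ[P] 0)
    (hWm : ∀ n, Measurable (W n))
    (hW : ∀ n, IndepFun (W n) (fun ω (i : Fin n) => (X i ω, Z i ω, A i ω, Y i ω)) P)
    (hfm : ∀ n, Measurable (Function.uncurry (fhat n)))
    (hfhat : TendstoInMeasure P (fun n ω => fhat n (W n ω) (X 0 ω)) atTop (fun ω => f₀ (X 0 ω)))
    {k : ℕ} (hk : k = 1 ∨ k = 3)
    (hfUI : UnifIntegrable
      (fun n ω => (fhat n (W n ω) (X 0 ω) - f₀ (X 0 ω)) * Z 0 ω * ‖X 0 ω‖) ((k + 1 : ℕ) : ℝ≥0∞) P) :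
    Tendsto (fun n => ∫⁻ ω, ‖nuisanceTerm X Z f₀ W fhat n ω‖ₑ ^ (k + 1) ∂P) atTop (𝓝 0) := by
  set O : ℕ → Ω → EuclideanSpace ℝ (Fin d) × ℝ × ℝ × ℝ :=
    fun i ω => (X i ω, Z i ω, A i ω, Y i ω) with hO
  have hOm : ∀ i, Measurable (O i) := fun i => by fun_prop
  have hwm := measurable_nuisance_weight hXm hZm hf₀ hWm hfm
  have hδ := tendsto_lintegral_enorm_pow_zero (Nat.succ_ne_zero k)
    (fun n => ((hwm n 0).mul (hXm 0).norm).aestronglyMeasurable) (by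
      have hm : ∀ n, AEStronglyMeasurable (fun ω => fhat n (W n ω) (X 0 ω)) P := fun n =>
        ((hfm n).comp ((hWm n).prodMk (hXm 0))).aestronglyMeasurable
      have := tendstoInMeasure_mul_fixed (g := fun ω => Z 0 ω * ‖X 0 ω‖) hfhat hm
        (hf₀.comp (hXm 0)).aestronglyMeasurable (by fun_prop)
      simp_rw [← mul_assoc] at this
      exact this) hfUI
  have hbound : ∀ᶠ n in atTop, ∫⁻ ω, ‖nuisanceTerm X Z f₀ W fhat n ω‖ₑ ^ (k + 1) ∂P
      -- `d ^ k` is the power-mean constant, `d` counts coordinates, and `3` is the fourth-moment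
      -- constant, which also covers `k = 1`.
      ≤ ((d ^ k * (d * 3) : ℝ≥0) : ℝ≥0∞) * ∫⁻ ω,
        ‖(fhat n (W n ω) (X 0 ω) - f₀ (X 0 ω)) * Z 0 ω * ‖X 0 ω‖‖ₑ ^ (k + 1) ∂P := by
    filter_upwards [eventually_gt_atTop 0] with n hn
    have hmeas : Measurable (nuisanceTerm X Z f₀ W fhat n) :=
      measurable_normalizedSum hXm (fun i => hwm n i) n
    refine (lintegral_enorm_pow_succ_le_sum (s := Finset.univ)
      (f := fun j ω => nuisanceTerm X Z f₀ W fhat n ω j)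
      (fun ω => EuclideanSpace.norm_le_sum_abs _) (fun j => by fun_prop) k).trans ?_
    rw [Finset.card_univ, Fintype.card_fin, ENNReal.coe_mul, mul_assoc]
    gcongr
    have hj : ∀ j, ∫⁻ ω, ‖nuisanceTerm X Z f₀ W fhat n ω j‖ₑ ^ (k + 1) ∂P ≤ 3 * ∫⁻ ω,
        ‖(fhat n (W n ω) (X 0 ω) - f₀ (X 0 ω)) * Z 0 ω * ‖X 0 ω‖‖ₑ ^ (k + 1) ∂P := fun j => by
      set g : 𝒲 × EuclideanSpace ℝ (Fin d) × ℝ × ℝ × ℝ → ℝ :=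
        fun q => (fhat n q.1 q.2.1 - f₀ q.2.1) * q.2.2.1 * q.2.1 j with hg
      have hfu : Measurable fun q : 𝒲 × EuclideanSpace ℝ (Fin d) × ℝ × ℝ × ℝ => fhat n q.1 q.2.1 :=
        (hfm n).comp (measurable_fst.prodMk measurable_snd.fst)
      have hgm : Measurable g := by fun_prop
      -- For frozen `w` the summand is `Z` times a function of `X`, so `E[Z | X] = 0` removes any
      -- bias from the estimate of `f₀`.
      have hg0 : ∀ w, Integrable (fun ω => g (w, O 0 ω)) P → ∫ ω, g (w, O 0 ω) ∂P = 0 := by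
        intro w hint
        have e : ∀ ω, g (w, O 0 ω) = Z 0 ω * ((fhat n w (X 0 ω) - f₀ (X 0 ω)) * X 0 ω j) :=
          fun ω => by simp only [hg, hO]; ring
        simp_rw [e] at hint ⊢
        have hfw : Measurable fun x => fhat n w x := (hfm n).comp measurable_prodMk_left
        exact integral_mul_comp_eq_zero_of_condExp_eq_zero (hXm 0) hZint hZX
          (h := fun x => (fhat n w x - f₀ x) * x j) (by fun_prop) hint
      have hmain : ∫⁻ ω, ‖nuisanceTerm X Z f₀ W fhat n ω j‖ₑ ^ (k + 1) ∂P
          ≤ 3 * ∫⁻ ω, ‖g (W n ω, O 0 ω)‖ₑ ^ (k + 1) ∂P := by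
        simp_rw [nuisanceTerm, normalizedSum_apply]
        rcases hk with rfl | rfl
        · change ∫⁻ ω, ‖(√n)⁻¹ * ∑ i ∈ Finset.range n, g (W n ω, O i ω)‖ₑ ^ 2 ∂P
            ≤ 3 * ∫⁻ ω, ‖g (W n ω, O 0 ω)‖ₑ ^ 2 ∂P
          refine (lintegral_enorm_normalized_sum_sq_le_of_indep (hWm n) hOm hindep hident (hW n)
            hgm hn hg0).trans ?_
          exact le_mul_of_one_le_left (zero_le) (by norm_num)
        · change ∫⁻ ω, ‖(√n)⁻¹ * ∑ i ∈ Finset.range n, g (W n ω, O i ω)‖ₑ ^ 4 ∂P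
            ≤ 3 * ∫⁻ ω, ‖g (W n ω, O 0 ω)‖ₑ ^ 4 ∂P
          exact lintegral_enorm_normalized_sum_pow_four_le_of_indep (hWm n) hOm hindep hident (hW n)
            hgm hn hg0
      refine hmain.trans (mul_le_mul_right (lintegral_mono fun ω => ?_) _)
      refine pow_le_pow_left₀ (zero_le) ?_ _
      change ‖(fhat n (W n ω) (X 0 ω) - f₀ (X 0 ω)) * Z 0 ω * X 0 ω j‖ₑ ≤ _
      rw [enorm_mul, enorm_mul _ ‖X 0 ω‖, enorm_norm]
      refine mul_le_mul_right ?_ _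
      rw [enorm_le_iff_norm_le]
      exact PiLp.norm_apply_le (X 0 ω) j
    refine (Finset.sum_le_sum fun j _ => hj j).trans (le_of_eq ?_)
    rw [Finset.sum_const, Finset.card_univ, Fintype.card_fin, nsmul_eq_mul, ← mul_assoc]
    push_cast
    rfl
  have h0 := ENNReal.Tendsto.const_mul (a := ((d ^ k * (d * 3) : ℝ≥0) : ℝ≥0∞)) hδ
    (Or.inr ENNReal.coe_ne_top)
  rw [mul_zero] at h0
  exact tendsto_of_tendsto_of_tendsto_of_le_of_le' tendsto_const_nhds h0
    (Eventually.of_forall fun _ => zero_le) hbound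

end nuisanceTerm
-- The main theorem.
theorem mainTheorem9 {Ω 𝒲 : Type*} [MeasurableSpace Ω] [MeasurableSpace 𝒲]
    (P : Measure Ω) [IsProbabilityMeasure P] (d : ℕ)
    -- the i.i.d. sample `(Xᵢ, Zᵢ, Aᵢ, Yᵢ)`
    (X : ℕ → Ω → EuclideanSpace ℝ (Fin d)) (Z A Y : ℕ → Ω → ℝ)
    (hXm : ∀ i, Measurable (X i)) (hZm : ∀ i, Measurable (Z i))
    (hAm : ∀ i, Measurable (A i)) (hYm : ∀ i, Measurable (Y i))
    (hindep : iIndepFun (fun i ω => (X i ω, Z i ω, A i ω, Y i ω)) P)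
    (hident : ∀ i, IdentDistrib (fun ω => (X i ω, Z i ω, A i ω, Y i ω))
      (fun ω => (X 0 ω, Z 0 ω, A 0 ω, Y 0 ω)) P P)
    -- the partially linear conditional IV model, with residual `ε`
    (θ₀ : EuclideanSpace ℝ (Fin d)) (f₀ : EuclideanSpace ℝ (Fin d) → ℝ) (hf₀ : Measurable f₀)
    (ε : Ω → ℝ) (hε : ε = structuralResidual θ₀ f₀ (X 0) (A 0) (Y 0))
    (hA : ∀ᵐ ω ∂P, A 0 ω = 0 ∨ A 0 ω = 1)
    (hZint : Integrable (Z 0) P)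
    (hZX : P[Z 0 | MeasurableSpace.comap (X 0) inferInstance] =ᵐ[P] 0)
    (hεint : Integrable ε P)
    (hεXZ : P[ε | MeasurableSpace.comap (fun ω => (X 0 ω, Z 0 ω)) inferInstance] =ᵐ[P] 0)
    -- existence of the matrices `V`, `J`, `Σ`, and of `J⁻¹`
    (hV : MemLp (X 0) 2 P)
    (hJ : Integrable (fun ω => A 0 ω * Z 0 ω * ‖X 0 ω‖ ^ 2) P)
    (hS : MemLp (fun ω => ε ω * Z 0 ω * ‖X 0 ω‖) 2 P)
    (hJinv : IsUnit (jacobianMatrix P (X 0) (Z 0) (A 0)))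
    -- the estimate of `f₀`: computed from auxiliary data `W n`, independent of the `n`
    -- observations, it converges to `f₀` in probability
    (W : ℕ → Ω → 𝒲) (hWm : ∀ n, Measurable (W n))
    (hW : ∀ n, IndepFun (W n)
      (fun ω (i : Fin n) => (X i ω, Z i ω, A i ω, Y i ω)) P)
    (fhat : ℕ → 𝒲 → EuclideanSpace ℝ (Fin d) → ℝ)
    (hfm : ∀ n, Measurable (Function.uncurry (fhat n)))
    (hfhat : TendstoInMeasure P (fun n ω => fhat n (W n ω) (X 0 ω)) atTop (fun ω => f₀ (X 0 ω)))
    (hfUI : UnifIntegrable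
      (fun n ω => (fhat n (W n ω) (X 0 ω) - f₀ (X 0 ω)) * Z 0 ω * ‖X 0 ω‖) 2 P)
    -- the estimator: a solution in `Θ` of the empirical moment equation, if there is one
    (Θ : Set (EuclideanSpace ℝ (Fin d))) (hΘ : θ₀ ∈ interior Θ)
    (θhat : ℕ → Ω → EuclideanSpace ℝ (Fin d)) (hθm : ∀ n, Measurable (θhat n))
    (hθΘ : ∀ n, ∀ᵐ ω ∂P, θhat n ω ∈ Θ)
    (hθ : ∀ n, ∀ᵐ ω ∂P, (∃ θ ∈ Θ, sampleMoment X Z A Y n ω (fhat n (W n ω)) θ = 0) →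
      sampleMoment X Z A Y n ω (fhat n (W n ω)) (θhat n ω) = 0)
    (U : Matrix (Fin d) (Fin d) ℝ)
    (hU : U = limitMatrix (covariateMatrix P (X 0)) (jacobianMatrix P (X 0) (Z 0) (A 0))
      (scoreMatrix P (X 0) (Z 0) ε)) :
    -- `n MSE(θ̂)` converges in law to a weighted sum of independent `χ²(1)` variables, whose
    -- mean is `‖U‖_nuclear` and whose variance is `2 ‖U‖²_Frobenius`
    (TendstoInDistribution (fun (n : ℕ) ω => (n : ℝ) * predictionMSE P (X 0) θ₀ (θhat n ω)) atTop
        (weightedSumSq (matrixSingularValue U)) (fun _ => P)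
        (Measure.pi fun _ : Fin d => gaussianReal 0 1) ∧
      MemLp (weightedSumSq (matrixSingularValue U)) 2
        (Measure.pi fun _ : Fin d => gaussianReal 0 1) ∧
      ∫ ξ, weightedSumSq (matrixSingularValue U) ξ ∂(Measure.pi fun _ : Fin d => gaussianReal 0 1)
        = nuclearNorm U ∧
      variance (weightedSumSq (matrixSingularValue U))
        (Measure.pi fun _ : Fin d => gaussianReal 0 1) = 2 * frobeniusNorm U ^ 2) ∧
    -- for a bounded parameter set and under fourth moments, the mean and the variance of
    -- `MSE(θ̂)` themselves converge
    (Bornology.IsBounded Θ →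
      MemLp (fun ω => ε ω * Z 0 ω * ‖X 0 ω‖) 4 P →
      MemLp (fun ω => A 0 ω * Z 0 ω * ‖X 0 ω‖ ^ 2) 4 P →
      UnifIntegrable
        (fun n ω => (fhat n (W n ω) (X 0 ω) - f₀ (X 0 ω)) * Z 0 ω * ‖X 0 ω‖) 4 P →
      (∀ n, MemLp (fun ω => predictionMSE P (X 0) θ₀ (θhat n ω)) 2 P) ∧
      Tendsto (fun n : ℕ => (n : ℝ) * ∫ ω, predictionMSE P (X 0) θ₀ (θhat n ω) ∂P) atTop
        (𝓝 (nuclearNorm U)) ∧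
      Tendsto (fun n : ℕ => (n : ℝ) ^ 2 *
          variance (fun ω => predictionMSE P (X 0) θ₀ (θhat n ω)) P) atTop
        (𝓝 (2 * frobeniusNorm U ^ 2))) := by
  -- the observations and their derived quantities
  set J := jacobianMatrix P (X 0) (Z 0) (A 0) with hJdef
  set V := covariateMatrix P (X 0) with hVdef
  set Sg := scoreMatrix P (X 0) (Z 0) ε with hSgdef
  set w : ℕ → Ω → ℝ := fun i ω => structuralResidual θ₀ f₀ (X i) (A i) (Y i) ω * Z i ω with hw
  have hw0 : ∀ ω, w 0 ω = ε ω * Z 0 ω := fun ω => by rw [hw, hε]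
  have hεm : Measurable ε := by rw [hε]; unfold structuralResidual; fun_prop
  have hwm : ∀ i, Measurable (w i) := fun i => by
    simp only [hw, structuralResidual]; fun_prop
  have hscore_m : Measurable fun o : EuclideanSpace ℝ (Fin d) × ℝ × ℝ × ℝ =>
      ((o.2.2.2 - inner ℝ θ₀ o.1 * o.2.2.1 - f₀ o.1) * o.2.1) • o.1 := by fun_prop
  have hjac_m : ∀ i j, Measurable fun o : EuclideanSpace ℝ (Fin d) × ℝ × ℝ × ℝ =>
      o.2.2.1 * o.2.1 * (o.1 i * o.1 j) := fun i j => by fun_prop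
  have hwind : iIndepFun (fun i ω => w i ω • X i ω) P := hindep.comp (fun _ => _) fun _ => hscore_m
  have hwid : ∀ i, IdentDistrib (fun ω => w i ω • X i ω) (fun ω => w 0 ω • X 0 ω) P P :=
    fun i => (hident i).comp hscore_m
  have hjind : ∀ i j, iIndepFun (fun k ω => A k ω * Z k ω * (X k ω i * X k ω j)) P :=
    fun i j => hindep.comp (fun _ => _) fun _ => hjac_m i j
  have hjid : ∀ i j k, IdentDistrib (fun ω => A k ω * Z k ω * (X k ω i * X k ω j))
      (fun ω => A 0 ω * Z 0 ω * (X 0 ω i * X 0 ω j)) P P :=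
    fun i j k => (hident k).comp (hjac_m i j)
  have hAZm : Measurable fun ω => A 0 ω * Z 0 ω := by fun_prop
  have hjint : ∀ i j, Integrable (fun ω => A 0 ω * Z 0 ω * (X 0 ω i * X 0 ω j)) P :=
    fun i j => integrable_weight_mul_coord (hXm 0) hAZm hJ i j
  have hS' : MemLp (fun ω => w 0 ω * ‖X 0 ω‖) 2 P := by simpa only [hw0] using hS
  have hwX : MemLp (fun ω => w 0 ω • X 0 ω) 2 P := memLp_smul_of_memLp_mul_norm (hXm 0) (hwm 0) hS'
  have hwt : ∀ t, ∫ ω, w 0 ω * inner ℝ (X 0 ω) t ∂P = 0 := fun t => by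
    have e : ∀ ω, w 0 ω * inner ℝ (X 0 ω) t = ε ω * (Z 0 ω * inner ℝ (X 0 ω) t) := fun ω => by
      rw [hw0, mul_assoc]
    simp_rw [e]
    refine integral_mul_comp_eq_zero_of_condExp_eq_zero ((hXm 0).prodMk (hZm 0)) hεint hεXZ
      (h := fun q : EuclideanSpace ℝ (Fin d) × ℝ => q.2 * inner ℝ q.1 t) (by fun_prop) ?_
    simp_rw [← e]
    have h1 : Integrable (fun ω => inner ℝ (w 0 ω • X 0 ω) t) P :=
      (hwX.integrable (by norm_num)).inner_const t
    simpa only [inner_smul_left, conj_trivial] using h1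
  have hwc : ∀ j, ∫ ω, w 0 ω * X 0 ω j ∂P = 0 := fun j => by
    simpa [EuclideanSpace.inner_single_right] using hwt (EuclideanSpace.single j 1)
  -- linear algebra
  have hJh : J.IsHermitian := isSymmetric_toEuclideanLin_integral (P := P) (X := X 0)
    (w := fun ω => A 0 ω * Z 0 ω) fun i j => rfl
  have hSint : Integrable (fun ω => (ε ω ^ 2 * Z 0 ω ^ 2) * ‖X 0 ω‖ ^ 2) P := by
    simpa only [mul_pow] using hS.integrable_sq
  have hSpos : (Matrix.toEuclideanLin Sg).IsPositive :=
    isPositive_toEuclideanLin_integral (hXm 0) (w := fun ω => ε ω ^ 2 * Z 0 ω ^ 2)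
      (fun ω => by positivity) (by fun_prop) hSint fun i j => rfl
  have hUpos : (Matrix.toEuclideanLin U).IsPositive := by rw [hU]; exact isPositive_limitMatrix hJh hSpos
  obtain ⟨b, hb⟩ := exists_orthonormalBasis_singularValue hUpos
  set lam := matrixSingularValue U with hlam
  have hlam0 : ∀ j, 0 ≤ lam j := fun j => (Matrix.toEuclideanLin U).singularValues_nonneg j
  set K := Matrix.toEuclideanLin J⁻¹ with hK
  -- `V^{1/2}` followed by coordinates in the eigenbasis of `U`. The rotation preserves norms, so
  -- `‖L T‖²` is still `n MSE`, while the limiting covariance becomes diagonal.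
  set L : EuclideanSpace ℝ (Fin d) →ₗ[ℝ] EuclideanSpace ℝ (Fin d) :=
    b.repr.toLinearEquiv.toLinearMap ∘ₗ Matrix.toEuclideanLin (CFC.sqrt V) with hL
  have hLnorm : ∀ u, ‖L u‖ = ‖Matrix.toEuclideanLin (CFC.sqrt V) u‖ := fun u => by
    simp [hL]
  set LK : EuclideanSpace ℝ (Fin d) →L[ℝ] EuclideanSpace ℝ (Fin d) :=
    LinearMap.toContinuousLinearMap (L ∘ₗ K) with hLK
  have hLKadj : ∀ x t, inner ℝ (LK x) t
      = inner ℝ x (K (Matrix.toEuclideanLin (CFC.sqrt V) (b.repr.symm t))) := fun x t => by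
    have hQ : (Matrix.toEuclideanLin (CFC.sqrt V)).IsSymmetric :=
      Matrix.isSymmetric_toEuclideanLin_iff.2
        (Matrix.nonneg_iff_posSemidef.1 (CFC.sqrt_nonneg V)).isHermitian
    have hJi : K.IsSymmetric := Matrix.isSymmetric_toEuclideanLin_iff.2 hJh.inv
    rw [← hJi, ← hQ, ← b.repr.inner_map_map _ (b.repr.symm t),
      LinearIsometryEquiv.apply_symm_apply]
    rfl
  -- With `u = ∑ tⱼ bⱼ`, the variance in direction `t` is `⟨u, U u⟩`.
  have hcov : ∀ t : EuclideanSpace ℝ (Fin d),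
      ∫ ω, inner ℝ (LK (w 0 ω • X 0 ω)) t ^ 2 ∂P = ∑ j, lam j * t j ^ 2 := fun t => by
    have h1 := inner_map_eq_sum_of_eigenbasis hUpos.isSymmetric b hb (b.repr.symm t)
    rw [LinearIsometryEquiv.apply_symm_apply] at h1
    rw [← h1, hU, inner_limitMatrix hJh, inner_toEuclideanLin_integral (hXm 0)
      (M := Sg) (w := fun ω => ε ω ^ 2 * Z 0 ω ^ 2) (by fun_prop) hSint fun i j => rfl]
    refine integral_congr_ae (ae_of_all _ fun ω => ?_)
    simp only [hLKadj, inner_smul_left, conj_trivial, hw0]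
    rw [real_inner_comm]
    ring
  -- constants
  obtain ⟨r, hr, hball⟩ := Metric.mem_nhds_iff.1 (mem_interior_iff_mem_nhds.1 hΘ)
  -- The added `1` keeps `κ` positive even when `d = 0`.
  set κ : ℝ≥0 := ⟨(∑ i, ∑ j, |J⁻¹ i j|) + 1, by positivity⟩ with hκdef
  have hκ : 0 < (κ : ℝ) := by
    change 0 < (∑ i, ∑ j, |J⁻¹ i j|) + 1
    positivity
  have hKκ : ∀ v, ‖K v‖ ≤ κ * ‖v‖ := fun v => by
    refine (norm_toEuclideanLin_le_sum J⁻¹ v).trans ?_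
    gcongr
    change _ ≤ (∑ i, ∑ j, |J⁻¹ i j|) + 1
    linarith
  have hc : 0 < 1 / (2 * (κ : ℝ)) := by positivity
  have hρ : 0 < r / (8 * (κ : ℝ)) := by positivity
  -- the random perturbations
  set D := jacobianDeviation X Z A J with hD
  set S := normalizedSum X w with hSdef
  set R := nuisanceTerm X Z f₀ W fhat with hRdef
  set T : ℕ → Ω → EuclideanSpace ℝ (Fin d) := fun n ω => √(n : ℝ) • (θhat n ω - θ₀) with hT
  have hDm : ∀ n, Measurable (D n) := measurable_jacobianDeviation hXm hZm hAm J
  have hSm : ∀ n, Measurable (S n) := measurable_normalizedSum hXm hwm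
  have hRm : ∀ n, Measurable (R n) := fun n =>
    measurable_normalizedSum hXm (fun i => measurable_nuisance_weight hXm hZm hf₀ hWm hfm n i) n
  have hD0 : ∀ n ω, 0 ≤ D n ω := fun n ω =>
    Finset.sum_nonneg fun i _ => Finset.sum_nonneg fun j _ => abs_nonneg _
  have hgood : ∀ n : ℕ, 0 < n → ∀ᵐ ω ∂P, D n ω ≤ 1 / (2 * κ) → ‖S n ω‖ ≤ r / (8 * κ) * √n →
      ‖R n ω‖ ≤ r / (8 * κ) * √n →
        ‖T n ω - K (S n ω)‖ ≤ κ * ‖R n ω‖ + 2 * κ ^ 2 * D n ω * (‖S n ω‖ + ‖R n ω‖) ∧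
        ‖T n ω‖ ≤ 2 * κ * (‖S n ω‖ + ‖R n ω‖) := fun n hn => by
    filter_upwards [hθ n] with ω hω h1 h2 h3
    exact moment_solution_bounds hn hJinv hκ hKκ hr hball (S := S n ω) (R := R n ω) rfl rfl hω h1 h2 h3
  have hmse : ∀ θ, predictionMSE P (X 0) θ₀ θ = ‖L (θ - θ₀)‖ ^ 2 := fun θ => by
    rw [predictionMSE_eq_norm_sq (hXm 0) hV, hLnorm]
  have hLT : ∀ (n : ℕ) ω, (n : ℝ) * predictionMSE P (X 0) θ₀ (θhat n ω) = ‖L (T n ω)‖ ^ 2 :=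
    fun n ω => by
      rw [hmse, hT, map_smul, norm_smul, mul_pow, Real.norm_of_nonneg (Real.sqrt_nonneg _),
        Real.sq_sqrt (Nat.cast_nonneg n)]
  have hRlim := tendsto_lintegral_nuisanceTerm hXm hZm hAm hYm hindep hident hf₀ hZint hZX hWm hW hfm
    hfhat (k := 1) (Or.inl rfl) hfUI
  have hlin : TendstoInMeasure P (fun n ω => T n ω - K (S n ω)) atTop (fun _ => 0) := by
    refine tendstoInMeasure_sub_of_linearization (S := S) hκ.le hc hρ hD0 ?_
      (tendstoInMeasure_jacobianDeviation hXm hZm hAm hjind hjid hjint) ?_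
      (tendstoInMeasure_zero_of_tendsto_lintegral_sq hRm hRlim)
    · filter_upwards [eventually_gt_atTop 0] with n hn
      filter_upwards [hgood n hn] with ω hω h1 h2 h3 using (hω h1 h2 h3).1
    · intro η hη
      refine measure_norm_ge_le_of_lintegral_sq_le hSm ?_
        (lintegral_enorm_sq_normalizedSum_le hXm hwm hwind hwid hwc) η hη
      refine ENNReal.mul_ne_top ENNReal.coe_ne_top (ENNReal.sum_ne_top.2 fun j _ => ?_)
      exact ((memLp_natCast_iff_lintegral_lt_top (m := 2) two_ne_zero
        ((hwm 0).mul (by fun_prop)).aestronglyMeasurable).1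
        (memLp_mul_coord_of_memLp_mul_norm (hXm 0) (hwm 0) hS' j)).ne
  have hclt := tendstoInDistribution_normalized_sum_diagonal (P := P)
    (ψ := fun i ω => LK (w i ω • X i ω)) (fun i => by fun_prop)
    (hwind.comp (fun _ => LK) fun _ => by fun_prop) (fun i => (hwid i).comp (by fun_prop))
    (LK.comp_memLp' hwX) (fun t => by
      have e : ∀ ω, inner ℝ (LK (w 0 ω • X 0 ω)) t = w 0 ω * inner ℝ (X 0 ω)
          (K (Matrix.toEuclideanLin (CFC.sqrt V) (b.repr.symm t))) := fun ω => by
        rw [hLKadj, inner_smul_left]; simp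
      simp_rw [e]
      exact hwt _) lam hlam0 hcov
  have hLS : ∀ (n : ℕ) ω, (√(n : ℝ))⁻¹ • ∑ i ∈ Finset.range n, LK (w i ω • X i ω)
      = LK (S n ω) := fun n ω => by
    rw [hSdef, normalizedSum, map_smul, map_sum]
  simp_rw [hLS] at hclt
  set Lc : EuclideanSpace ℝ (Fin d) →L[ℝ] EuclideanSpace ℝ (Fin d) :=
    LinearMap.toContinuousLinearMap L with hLc
  have hdist : TendstoInDistribution (fun n ω => Lc (T n ω)) atTop
      (fun ξ => (WithLp.toLp 2 fun j => √(lam j) * ξ j : EuclideanSpace ℝ (Fin d)))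
      (fun _ => P) (Measure.pi fun _ : Fin d => gaussianReal 0 1) := by
    -- Slutsky: `L T` and `L J⁻¹ S` differ by a term tending to `0` in probability.
    refine tendstoInDistribution_of_tendstoInMeasure_sub _ _ hclt ?_ fun n => by fun_prop
    have h1 := tendstoInMeasure_clm_comp Lc hlin
    simp_rw [map_sub] at h1
    exact h1
  have hW2 : ∀ ξ : Fin d → ℝ, weightedSumSq lam ξ
      = ‖(WithLp.toLp 2 fun j => √(lam j) * ξ j : EuclideanSpace ℝ (Fin d))‖ ^ 2 := fun ξ => by
    rw [EuclideanSpace.norm_sq_eq, weightedSumSq]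
    refine Finset.sum_congr rfl fun j _ => ?_
    simp only [Real.norm_eq_abs, sq_abs, mul_pow, Real.sq_sqrt (hlam0 j)]
  have hpart1 : TendstoInDistribution
      (fun (n : ℕ) ω => (n : ℝ) * predictionMSE P (X 0) θ₀ (θhat n ω)) atTop
      (weightedSumSq lam) (fun _ => P) (Measure.pi fun _ : Fin d => gaussianReal 0 1) := by
    have h1 := hdist.continuous_comp (g := fun x => ‖x‖ ^ 2) (by fun_prop)
    convert! h1 using 1
    · ext n ω; exact hLT n ω
    · ext ξ; exact hW2 ξ
  have hmemW := memLp_weightedSumSq lam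
  have hintW : ∫ ξ, weightedSumSq lam ξ ∂(Measure.pi fun _ : Fin d => gaussianReal 0 1)
      = nuclearNorm U := integral_weightedSumSq lam
  have hvarW : variance (weightedSumSq lam) (Measure.pi fun _ : Fin d => gaussianReal 0 1)
      = 2 * frobeniusNorm U ^ 2 := by
    rw [variance_weightedSumSq, frobeniusNorm_sq_eq_sum hUpos]
  refine ⟨⟨hpart1, hmemW, hintW, hvarW⟩, fun hbdd hε4 hAZ4 hfUI4 => ?_⟩
  -- convergence of the moments
  obtain ⟨B, hB0, hB⟩ : ∃ B : ℝ, 0 ≤ B ∧ ∀ θ ∈ Θ, ‖θ - θ₀‖ ≤ B := by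
    obtain ⟨C, hC⟩ := hbdd.subset_closedBall θ₀
    refine ⟨max C 0, le_max_right _ _, fun θ hθ' => ?_⟩
    have := hC hθ'
    rw [mem_closedBall_iff_norm] at this
    exact this.trans (le_max_left _ _)
  set M : ℕ → Ω → ℝ := fun n ω => predictionMSE P (X 0) θ₀ (θhat n ω) with hM
  have hM0 : ∀ n ω, 0 ≤ M n ω := fun n ω => by
    simp only [hM, hmse]; positivity
  have hMm : ∀ n, Measurable (M n) := fun n => by
    have e : M n = fun ω => ‖Lc (θhat n ω - θ₀)‖ ^ 2 := funext fun ω => hmse _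
    rw [e]; fun_prop
  have hMbd : ∀ n, ∀ᵐ ω ∂P, ‖M n ω‖ ≤ (‖Lc‖ * B) ^ 2 := fun n => by
    filter_upwards [hθΘ n] with ω hω
    rw [Real.norm_of_nonneg (hM0 n ω)]
    simp only [hM, hmse]
    refine pow_le_pow_left₀ (norm_nonneg _) ?_ 2
    exact (Lc.le_opNorm _).trans (mul_le_mul_of_nonneg_left (hB _ hω) (norm_nonneg _))
  have hMmem : ∀ n, MemLp (M n) 2 P := fun n =>
    MemLp.of_bound (hMm n).aestronglyMeasurable _ (hMbd n)
  have hS4 : ∀ j, MemLp (fun ω => w 0 ω * X 0 ω j) 4 P := fun j =>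
    memLp_mul_coord_of_memLp_mul_norm (hXm 0) (hwm 0) (by simpa only [hw0] using hε4) j
  have hJ4 : ∀ i j, MemLp (fun ω => A 0 ω * Z 0 ω * (X 0 ω i * X 0 ω j)) 4 P := fun i j => by
    refine hAZ4.mono (by fun_prop) (ae_of_all _ fun ω => ?_)
    rw [norm_mul, norm_mul (X 0 ω i), norm_mul (A 0 ω * Z 0 ω) (‖X 0 ω‖ ^ 2), norm_pow, norm_norm, sq]
    gcongr
    · exact PiLp.norm_apply_le (X 0 ω) i
    · exact PiLp.norm_apply_le (X 0 ω) j
  have hTUI : AsympUnifIntegrable P fun n ω => ‖T n ω‖ₑ ^ 4 := by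
    refine asympUnifIntegrable_pow_four_of_linearization (B := ⟨B, hB0⟩) (κ := 2 * κ) hc hρ ?_ ?_
      hDm hSm hRm (asympUnifIntegrable_jacobianDeviation hXm hZm hAm hjind hjid hJ4)
      (asympUnifIntegrable_normalizedSum hXm hwm hwind hwid hwc hS4)
      (tendsto_lintegral_nuisanceTerm hXm hZm hAm hYm hindep hident hf₀ hZint hZX hWm hW hfm hfhat
        (k := 3) (Or.inr rfl) hfUI4)
    · filter_upwards [eventually_gt_atTop 0] with n hn
      filter_upwards [hgood n hn] with ω hω h1 h2 h3
      push_cast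
      exact (hω h1 h2 h3).2
    · refine Eventually.of_forall fun n => ?_
      filter_upwards [hθΘ n] with ω hω
      simp only [hT]
      rw [norm_smul, Real.norm_of_nonneg (Real.sqrt_nonneg _), mul_comm]
      exact mul_le_mul_of_nonneg_right (hB _ hω) (Real.sqrt_nonneg _)
  have hM2UI : AsympUnifIntegrable P fun (n : ℕ) ω => ENNReal.ofReal (((n : ℝ) * M n ω) ^ 2) := by
    refine (hTUI.const_mul (‖Lc‖₊ ^ 4)).mono (Eventually.of_forall fun n => ae_of_all _ fun ω => ?_)
    rw [hM, hLT, ← pow_mul, ENNReal.ofReal_pow (norm_nonneg _), ofReal_norm, ENNReal.coe_pow,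
      ← mul_pow]
    exact pow_le_pow_left₀ (zero_le) (Lc.le_opENorm _) 4
  have hM1UI : AsympUnifIntegrable P fun (n : ℕ) ω => ENNReal.ofReal ((n : ℝ) * M n ω) := by
    have h1 : AsympUnifIntegrable P fun (_ : ℕ) (_ : Ω) => (1 : ℝ≥0∞) := fun η _ => ⟨1, by simp⟩
    -- Uniform integrability of `x = n MSE` follows from that of `x²` through `x ≤ 1 + x²`.
    refine (h1.add hM2UI fun _ => measurable_const).mono
      (Eventually.of_forall fun n => ae_of_all _ fun ω => ?_)
    rw [← ENNReal.ofReal_one, ← ENNReal.ofReal_add zero_le_one (sq_nonneg _)]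
    refine ENNReal.ofReal_le_ofReal ?_
    nlinarith [sq_nonneg ((n : ℝ) * M n ω - 1)]
  have hnM0 : ∀ (n : ℕ) ω, 0 ≤ (n : ℝ) * M n ω := fun n ω => mul_nonneg (Nat.cast_nonneg n) (hM0 n ω)
  have hWn : ∀ ξ, 0 ≤ weightedSumSq lam ξ := fun ξ => by rw [hW2]; positivity
  have hmean : Tendsto (fun n : ℕ => (n : ℝ) * ∫ ω, M n ω ∂P) atTop (𝓝 (nuclearNorm U)) := by
    have h1 := hpart1.tendsto_integral hM1UI
      (fun n => ((hMmem n).integrable (by norm_num)).const_mul _) hnM0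
      (hmemW.integrable (by norm_num)) hWn
    rw [hintW] at h1
    simpa only [integral_const_mul] using h1
  have hsq : Tendsto (fun n : ℕ => (n : ℝ) ^ 2 * ∫ ω, M n ω ^ 2 ∂P) atTop
      (𝓝 (2 * frobeniusNorm U ^ 2 + nuclearNorm U ^ 2)) := by
    have h0 := hpart1.continuous_comp (g := fun x : ℝ => x ^ 2) (by fun_prop)
    have h1 := h0.tendsto_integral hM2UI
      (fun n => ((hMmem n).const_mul (n : ℝ)).integrable_sq) (fun n ω => sq_nonneg _)
      hmemW.integrable_sq fun ξ => sq_nonneg _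
    have h2 := variance_eq_sub hmemW
    rw [hvarW, hintW] at h2
    have h3 : ∫ ξ, ((fun x : ℝ => x ^ 2) ∘ weightedSumSq lam) ξ
        ∂(Measure.pi fun _ : Fin d => gaussianReal 0 1)
        = 2 * frobeniusNorm U ^ 2 + nuclearNorm U ^ 2 := by
      rw [h2, sub_add_cancel]; rfl
    rw [h3] at h1
    refine h1.congr fun n => ?_
    simp only [Function.comp_def]
    simp_rw [mul_pow]
    rw [integral_const_mul]
  refine ⟨hMmem, hmean, ?_⟩
  -- `n² Var M = n² E[M²] - (n E M)²`, and the squared nuclear norm cancels in the limit.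
  have h1 := hsq.sub (hmean.pow 2)
  rw [add_sub_cancel_right] at h1
  refine h1.congr fun n => ?_
  rw [variance_eq_sub (hMmem n)]
  simp only [Pi.pow_apply]
  ring
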